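/- Let $d\ge 1$ and $\mathbb{T}^d=\mathbb{R}^d/\mathbb{Z}^d$, and for $g\in L^1(\mathbb{T}^d)$ and $k\in\mathbb{Z}^d$ let $(\mathcal{F}g)(k)=\widehat g(k)=\int_{\mathbb{T}^d}g(x)e^{-2\pi i\langle k,x\rangle}\,dx$. For $s>0$, let $W^{s,2}(\mathbb{T}^d)$ be the space of all complex-valued $w\in L^2(\mathbb{T}^d)$ with $\sum_{k\in\mathbb{Z}^d}|k|^{2s}|\widehat w(k)|^2<\infty$, where $|k|$ is the Euclidean norm. For $2\le q\le\infty$, let $\mathcal{M}_2^q$ be the set of all $u\in L^2(\mathbb{T}^d)$ for which the operator $T_ua=\mathcal{F}(u\,\mathcal{F}^{-1}a)$ is bounded from $\ell^2(\mathbb{Z}^d)$ to $\ell^q(\mathbb{Z}^d)$. For a function $w$ on $\mathbb{T}^d$, write $1/w\in\mathcal{M}_2^q$ if $w\neq0$ almost everywhere and the almost everywhere defined function $1/w$ belongs to $\mathcal{M}_2^q$. When $s>d/2$, every $w\in W^{s,2}(\mathbb{T}^d)$ has a continuous representative, and "$w$ has a zero" means that this representative vanishes at some point of $\mathbb{T}^d$.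 Put $c/0=\infty$ for $c>0$. **Theorem.** Let $\frac d2<s\le d$. (i) Suppose $s<\frac d2+1$. If $w\in W^{s,2}(\mathbb{T}^d)$ has a zero, then $1/w\notin\mathcal{M}_2^q$ for every $q\in[2,\infty]$ with $q\le\frac{d}{d-s}$. Conversely, for every $q\in[2,\infty]$ with $q>\frac{d}{d-s}$ there is a $w\in W^{s,2}(\mathbb{T}^d)$ that has a zero and satisfies $1/w\in\mathcal{M}_2^q$. (ii) Suppose $s=\frac d2+1$. If $w\in W^{s,2}(\mathbb{T}^d)$ has a zero, then $1/w\notin\mathcal{M}_2^q$ for every $q$ with $2\le q<\frac{2d}{d-2}$. -/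

import Mathlib

open MeasureTheory
open scoped ENNReal

noncomputable section

/-- The normalized Lebesgue measure of the torus `𝕋^d = ℝ^d / ℤ^d`: the product of the Haar
probability measures of the circles `ℝ / ℤ`. It is the measure with respect to which
`UnitAddTorus.mFourierCoeff` and `UnitAddTorus.mFourierBasis` are defined. -/
abbrev torusMeasure (d : ℕ) : Measure (UnitAddTorus (Fin d)) :=
  Measure.pi fun _ => AddCircle.haarAddCircle

/-- Membership of `w` in the periodic Sobolev space `W^{s,2}(𝕋^d)`: `w` is in `L²(𝕋^d)` and
`∑_{k ∈ ℤ^d} |k|^{2s} |ŵ(k)|²` is finite, where `|k|` is the Euclidean norm of `k`. Here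
`ŵ(k) = ∫ w(x) e^{-2πi⟨k,x⟩} dx`. -/
def MemSobolevTorus (d : ℕ) (s : ℝ) (w : UnitAddTorus (Fin d) → ℂ) : Prop :=
  MemLp w 2 (torusMeasure d) ∧
    Summable fun k : Fin d → ℤ =>
      ‖WithLp.toLp 2 (fun i => (k i : ℝ))‖ ^ (2 * s) * ‖UnitAddTorus.mFourierCoeff w k‖ ^ 2

/-- The continuous representative of `w` has a zero. -/
def HasZeroTorus (d : ℕ) (w : UnitAddTorus (Fin d) → ℂ) : Prop :=
  ∃ g : UnitAddTorus (Fin d) → ℂ, Continuous g ∧ g =ᵐ[torusMeasure d] w ∧ ∃ x, g x = 0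

/-- The sequence `T_u a = ℱ(u ℱ⁻¹ a)` for `a ∈ ℓ²(ℤ^d)`, where `ℱ⁻¹ a` is the function in `L²(𝕋^d)`
with Fourier coefficients `a`, and `ℱ` takes a function in `L¹(𝕋^d)` to its Fourier
coefficients. -/
def multiplierSeq (d : ℕ) (u : UnitAddTorus (Fin d) → ℂ)
    (a : lp (fun _ : Fin d → ℤ => ℂ) 2) : (Fin d → ℤ) → ℂ :=
  UnitAddTorus.mFourierCoeff fun x =>
    u x * ((UnitAddTorus.mFourierBasis (d := Fin d)).repr.symm a) x

/-- `u ∈ M_2^q`: the function `u` is in `L²(𝕋^d)`, and `T_u` is a bounded operator from `ℓ²(ℤ^d)`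
to `ℓ^q(ℤ^d)`. -/
def IsTwoMultiplier (d : ℕ) (q : ℝ≥0∞) (u : UnitAddTorus (Fin d) → ℂ) : Prop :=
  MemLp u 2 (torusMeasure d) ∧
    ∃ C : ℝ, ∀ a : lp (fun _ : Fin d → ℤ => ℂ) 2,
      ∃ h : Memℓp (multiplierSeq d u a) q,
        ‖(⟨multiplierSeq d u a, h⟩ : lp (fun _ : Fin d → ℤ => ℂ) q)‖ ≤ C * ‖a‖

/-- `1/w ∈ M_2^q`. As division by zero gives `0` in Lean, the condition that `1/w` is defined almost
everywhere is stated explicitly. -/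
def RecipIsTwoMultiplier (d : ℕ) (q : ℝ≥0∞) (w : UnitAddTorus (Fin d) → ℂ) : Prop :=
  (∀ᵐ x ∂torusMeasure d, w x ≠ 0) ∧
    IsTwoMultiplier d q (fun x => 1 / w x)

end

/-! ### Fourier coefficients on the torus -/

/-! Necessity. Let d/2 < s < d/2 + 1. Cauchy–Schwarz applied to Σ ŵ(k)(e(k·x) - e(k·x₀)) shows that
w is o(r^(s-d/2)) at distance r from a zero x₀ (`exists_tendsto_bound_near_zero`). Let B be a cube
of side about 1/N around x₀, of volume V ≈ N^(-d). The operator T_{1/w} maps the coefficients of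
w·1_B, of ℓ² norm √V·o(N^(-(s-d/2))), to those of 1_B, which are at least V/2 in modulus at about
N^d frequencies. Boundedness into ℓ^q would give N^(d/q-(d-s)) = o(1), which is false when d/q ≥
d-s; the little o is what settles the endpoint (`not_recipIsTwoMultiplier_of_hasZero`). For s = d/2
+ 1, the strict bound on q leaves room to pass to a slightly smaller order.

Sharpness. Take w = (1-P)^β with P = ∏ cos²(πxᵢ), which vanishes only at 0. The binomial series
writes (1-P)^(-γ), for γ = ±β, as Σ cₙPⁿ with cₙ = O(n^(γ-1)). The power Pⁿ is a bump of width
n^(-1/2) whose Fourier coefficients are products of normalized binomial coefficients concentrated on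
|k| ≲ √n. Hence its Sobolev seminorm of order s is O(n^(s/2-d/4)), and w lies in W^{s,2} if β > s/2
- d/4. Multiplication by Pⁿ has norm at most 1 from ℓ² to ℓ² and O(n^(-d/4)) from ℓ² to ℓ^∞, hence
O(n^(-(d/4)(1-2/q))) into ℓ^q, and 1/w is a multiplier if β < (d/4)(1-2/q). The two conditions are
compatible exactly when d/q < d-s. -/

theorem mFourierCoeff_eq_integral_torusMeasure {d : ℕ} (f : UnitAddTorus (Fin d) → ℂ)
    (k : Fin d → ℤ) :
    UnitAddTorus.mFourierCoeff f k = ∫ x, UnitAddTorus.mFourier (-k) x * f x ∂torusMeasure d :=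
  rfl

theorem mFourierCoeff_congr_ae {d : ℕ} {f g : UnitAddTorus (Fin d) → ℂ}
    (h : f =ᵐ[torusMeasure d] g) : UnitAddTorus.mFourierCoeff f = UnitAddTorus.mFourierCoeff g := by
  ext k
  simp only [mFourierCoeff_eq_integral_torusMeasure]
  refine integral_congr_ae ?_
  filter_upwards [h] with x hx
  rw [hx]

theorem norm_mFourier_apply {d : ℕ} (k : Fin d → ℤ) (x : UnitAddTorus (Fin d)) :
    ‖UnitAddTorus.mFourier k x‖ = 1 := by
  simp only [UnitAddTorus.mFourier, ContinuousMap.coe_mk, norm_prod, fourier_apply, Circle.norm_coe,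
    Finset.prod_const_one]

/-- The sequence of Fourier coefficients of a square integrable function. -/
noncomputable def fourierSeq {d : ℕ} {f : UnitAddTorus (Fin d) → ℂ}
    (hf : MemLp f 2 (torusMeasure d)) : lp (fun _ : Fin d → ℤ => ℂ) 2 :=
  (UnitAddTorus.mFourierBasis (d := Fin d)).repr (hf.toLp f)

theorem fourierSeq_apply {d : ℕ} {f : UnitAddTorus (Fin d) → ℂ}
    (hf : MemLp f 2 (torusMeasure d)) (k : Fin d → ℤ) :
    fourierSeq hf k = UnitAddTorus.mFourierCoeff f k := by
  refine (UnitAddTorus.mFourierBasis_repr _ k).trans ?_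
  rw [mFourierCoeff_congr_ae hf.coeFn_toLp]

theorem norm_fourierSeq {d : ℕ} {f : UnitAddTorus (Fin d) → ℂ}
    (hf : MemLp f 2 (torusMeasure d)) :
    ‖fourierSeq hf‖ = (eLpNorm f 2 (torusMeasure d)).toReal := by
  refine (LinearIsometryEquiv.norm_map _ _).trans ?_
  exact Lp.norm_toLp f hf

theorem multiplierSeq_fourierSeq {d : ℕ} (u : UnitAddTorus (Fin d) → ℂ)
    {f : UnitAddTorus (Fin d) → ℂ} (hf : MemLp f 2 (torusMeasure d)) :
    multiplierSeq d u (fourierSeq hf) = UnitAddTorus.mFourierCoeff fun x => u x * f x := by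
  refine mFourierCoeff_congr_ae ?_
  have h : ((UnitAddTorus.mFourierBasis (d := Fin d)).repr.symm (fourierSeq hf) :
      Lp ℂ 2 (torusMeasure d)) = hf.toLp f :=
    LinearIsometryEquiv.symm_apply_apply _ _
  have h2 := hf.coeFn_toLp
  rw [← h] at h2
  filter_upwards [h2] with x hx
  exact congrArg (u x * ·) hx

/-- Every square summable sequence consists of the Fourier coefficients of a function in `L²`. -/
theorem exists_fourierSeq_eq {d : ℕ} (a : lp (fun _ : Fin d → ℤ => ℂ) 2) :
    ∃ (f : UnitAddTorus (Fin d) → ℂ) (hf : MemLp f 2 (torusMeasure d)), fourierSeq hf = a := by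
  let F : Lp ℂ 2 (torusMeasure d) := (UnitAddTorus.mFourierBasis (d := Fin d)).repr.symm a
  refine ⟨F, Lp.memLp F, ?_⟩
  have : (Lp.memLp F).toLp F = F := Lp.toLp_coeFn F _
  unfold fourierSeq
  rw [this]
  exact LinearIsometryEquiv.apply_symm_apply _ _

/-! ### Characters near a point and small cubes -/

/-- The norm on the circle is the distance to the nearest integer, so the lift of least modulus is z
- round z. -/
theorem exists_real_lift (t : UnitAddCircle) : ∃ r : ℝ, (r : UnitAddCircle) = t ∧ |r| = ‖t‖ := by
  induction t using QuotientAddGroup.induction_on with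
  | H z =>
    refine ⟨z - round z, ?_, ?_⟩
    · have h1 : ((round z : ℝ) : UnitAddCircle) = 0 := by
        rw [AddCircle.coe_eq_zero_iff]
        exact ⟨round z, by simp⟩
      rw [AddCircle.coe_sub, h1, sub_zero]
    · exact (UnitAddCircle.norm_eq (x := z)).symm

theorem norm_mFourier_sub_one_le {d : ℕ} (k : Fin d → ℤ) (x : UnitAddTorus (Fin d)) :
    ‖UnitAddTorus.mFourier k x - 1‖ ≤ 2 * Real.pi * d * (‖k‖ * ‖x‖) := by
  choose r hr hr' using fun i => exists_real_lift (x i)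
  have h : UnitAddTorus.mFourier k x =
      Complex.exp (Complex.I * ((2 * Real.pi * ∑ i, (k i : ℝ) * r i : ℝ) : ℂ)) := by
    have : ∀ i, fourier (k i) (x i) =
        Complex.exp (Complex.I * ((2 * Real.pi * ((k i : ℝ) * r i) : ℝ) : ℂ)) := by
      intro i
      rw [← hr i, fourier_coe_apply]
      congr 1
      push_cast
      ring
    simp only [UnitAddTorus.mFourier, ContinuousMap.coe_mk, this]
    rw [← Complex.exp_sum]
    congr 1
    push_cast
    rw [Finset.mul_sum, Finset.mul_sum]
  rw [h]
  refine (Real.norm_exp_I_mul_ofReal_sub_one_le).trans ?_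
  rw [Real.norm_eq_abs, abs_mul, abs_of_pos (by positivity), mul_assoc _ (d : ℝ)]
  refine mul_le_mul_of_nonneg_left ?_ (by positivity)
  refine (Finset.abs_sum_le_sum_abs _ _).trans ?_
  refine (Finset.sum_le_card_nsmul _ _ (‖k‖ * ‖x‖) fun i _ => ?_).trans (by simp)
  rw [abs_mul, hr']
  have h1 := norm_le_pi_norm k i
  rw [Int.norm_eq_abs] at h1
  exact mul_le_mul h1 (norm_le_pi_norm x i) (norm_nonneg _) (norm_nonneg _)

theorem norm_mFourier_sub_mFourier_le {d : ℕ} (k : Fin d → ℤ) (x y : UnitAddTorus (Fin d)) :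
    ‖UnitAddTorus.mFourier k x - UnitAddTorus.mFourier k y‖ ≤
      2 * Real.pi * d * (‖k‖ * dist x y) := by
  have h : UnitAddTorus.mFourier k x =
      UnitAddTorus.mFourier k (x - y) * UnitAddTorus.mFourier k y := by
    simp only [UnitAddTorus.mFourier, ContinuousMap.coe_mk, ← Finset.prod_mul_distrib]
    refine Finset.prod_congr rfl fun i _ => ?_
    simp only [fourier_apply, Pi.sub_apply, ← Circle.coe_mul, ← AddCircle.toCircle_add,
      ← smul_add, sub_add_cancel]
  rw [h, ← sub_one_mul, norm_mul, norm_mFourier_apply, mul_one, dist_eq_norm]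
  exact norm_mFourier_sub_one_le k (x - y)

theorem norm_mFourier_sub_mFourier_le_two_mul_min {d : ℕ} {N : ℝ} (hN : 0 < N) (k : Fin d → ℤ)
    {x y : UnitAddTorus (Fin d)} (hxy : d * dist x y ≤ 1 / (16 * N)) :
    ‖UnitAddTorus.mFourier k x - UnitAddTorus.mFourier k y‖ ≤ 2 * min 1 (‖k‖ / N) := by
  rw [mul_min_of_nonneg _ _ zero_le_two]
  refine le_min ?_ ?_
  · refine (norm_sub_le _ _).trans ?_
    simp only [norm_mFourier_apply]
    norm_num
  · refine (norm_mFourier_sub_mFourier_le k x y).trans ?_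
    have h1 : 2 * Real.pi * d * (‖k‖ * dist x y) = 2 * Real.pi * ‖k‖ * (d * dist x y) := by ring
    rw [h1]
    refine (mul_le_mul_of_nonneg_left hxy (by positivity)).trans ?_
    have h2 : 2 * Real.pi * ‖k‖ * (1 / (16 * N)) = (Real.pi / 8) * (‖k‖ / N) := by
      field_simp; ring
    rw [h2]
    exact mul_le_mul_of_nonneg_right (by linarith [Real.pi_lt_four]) (by positivity)

theorem haarAddCircle_closedBall (x : UnitAddCircle) {ρ : ℝ} (hρ : 2 * ρ ≤ 1) :
    AddCircle.haarAddCircle (Metric.closedBall x ρ) = ENNReal.ofReal (2 * ρ) := by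
  have h := AddCircle.volume_closedBall (1 : ℝ) (x := x) ρ
  rw [AddCircle.volume_eq_smul_haarAddCircle, min_eq_right hρ] at h
  simpa using h

theorem torusMeasure_closedBall {d : ℕ} (x : UnitAddTorus (Fin d)) {ρ : ℝ} (h0 : 0 ≤ ρ)
    (hρ : 2 * ρ ≤ 1) :
    torusMeasure d (Metric.closedBall x ρ) = ENNReal.ofReal ((2 * ρ) ^ d) := by
  rw [closedBall_pi _ h0, Measure.pi_pi]
  simp only [haarAddCircle_closedBall _ hρ, Finset.prod_const, Finset.card_univ, Fintype.card_fin]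
  rw [ENNReal.ofReal_pow (by positivity)]

/-- The low-frequency Fourier coefficients of the indicator function of a small cube are at least
half the volume of the cube. -/
theorem le_norm_mFourierCoeff_indicator {d : ℕ} {N ρ : ℝ} (hN : 1 ≤ N) (h0 : 0 ≤ ρ)
    (hρ : 2 * ρ ≤ 1) (hdρ : d * ρ ≤ 1 / (16 * N)) (x₀ : UnitAddTorus (Fin d)) {k : Fin d → ℤ}
    (hk : ‖k‖ ≤ N) :
    (2 * ρ) ^ d / 2 ≤
      ‖UnitAddTorus.mFourierCoeff ((Metric.closedBall x₀ ρ).indicator fun _ => (1 : ℂ)) k‖ := by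
  set B := Metric.closedBall x₀ ρ
  have hB : (torusMeasure d).real B = (2 * ρ) ^ d := by
    rw [Measure.real, torusMeasure_closedBall x₀ h0 hρ, ENNReal.toReal_ofReal (by positivity)]
  have hBm : MeasurableSet B := Metric.isClosed_closedBall.measurableSet
  have h1 : UnitAddTorus.mFourierCoeff (B.indicator fun _ => (1 : ℂ)) k =
      ∫ x in B, UnitAddTorus.mFourier (-k) x ∂torusMeasure d := by
    rw [mFourierCoeff_eq_integral_torusMeasure, ← integral_indicator hBm]
    refine integral_congr_ae (.of_forall fun x => ?_)
    by_cases hx : x ∈ B <;> simp [hx]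
  have hint : IntegrableOn (fun x => UnitAddTorus.mFourier (-k) x) B (torusMeasure d) :=
    ((UnitAddTorus.mFourier (-k)).continuous.integrable_of_hasCompactSupport
      (HasCompactSupport.of_compactSpace _)).integrableOn
  -- For |k| ≤ N the character moves by at most 2πN/(16N) = π/8 ≤ 1/2 on the cube; this fixes the
  -- constant 16.
  have h2 : ‖(∫ x in B, UnitAddTorus.mFourier (-k) x ∂torusMeasure d) -
      ((2 * ρ) ^ d : ℝ) * UnitAddTorus.mFourier (-k) x₀‖ ≤ 1 / 2 * (2 * ρ) ^ d := by
    have h3 : ((2 * ρ) ^ d : ℝ) * UnitAddTorus.mFourier (-k) x₀ =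
        ∫ _x in B, UnitAddTorus.mFourier (-k) x₀ ∂torusMeasure d := by
      rw [setIntegral_const, hB]
      simp
    rw [h3, ← integral_sub hint (by simp), ← hB]
    refine norm_setIntegral_le_of_norm_le_const (measure_lt_top _ _) fun x hx => ?_
    refine (norm_mFourier_sub_mFourier_le (-k) x x₀).trans ?_
    rw [norm_neg]
    have hd : d * dist x x₀ ≤ 1 / (16 * N) :=
      (mul_le_mul_of_nonneg_left hx (Nat.cast_nonneg d)).trans hdρ
    calc 2 * Real.pi * d * (‖k‖ * dist x x₀) = 2 * Real.pi * (‖k‖ * (d * dist x x₀)) := by ring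
      _ ≤ 2 * Real.pi * (N * (1 / (16 * N))) := by gcongr
      _ = Real.pi / 8 := by field_simp; ring
      _ ≤ 1 / 2 := by linarith [Real.pi_lt_four]
  have h4 : ‖(((2 * ρ) ^ d : ℝ) : ℂ) * UnitAddTorus.mFourier (-k) x₀‖ = (2 * ρ) ^ d := by
    rw [norm_mul, norm_mFourier_apply, mul_one, Complex.norm_real, Real.norm_eq_abs,
      abs_of_nonneg (by positivity)]
  rw [h1]
  have h5 := norm_sub_norm_le (((2 * ρ) ^ d : ℝ) * UnitAddTorus.mFourier (-k) x₀)
    (∫ x in B, UnitAddTorus.mFourier (-k) x ∂torusMeasure d)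
  rw [h4, norm_sub_rev] at h5
  linarith

theorem card_mul_le_lp_norm {ι : Type*} {q : ℝ≥0∞} (hq : q ≠ 0) (f : lp (fun _ : ι => ℂ) q)
    {S : Finset ι} (hS : S.Nonempty) {c : ℝ} (hc : 0 ≤ c) (h : ∀ i ∈ S, c ≤ ‖f i‖) :
    c * (S.card : ℝ) ^ (q.toReal⁻¹) ≤ ‖f‖ := by
  -- For q = ∞ the exponent `q.toReal⁻¹` is 0, so a single index suffices.
  rcases eq_or_ne q ∞ with rfl | hq'
  · obtain ⟨i, hi⟩ := hS
    simpa using (h i hi).trans (lp.norm_apply_le_norm hq f i)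
  · have hq0 : 0 < q.toReal := ENNReal.toReal_pos hq hq'
    have h1 : (S.card : ℝ) * c ^ q.toReal ≤ ‖f‖ ^ q.toReal := by
      refine le_trans ?_ (lp.sum_rpow_le_norm_rpow hq0 f S)
      rw [← nsmul_eq_mul]
      exact Finset.card_nsmul_le_sum _ _ _ fun i hi => Real.rpow_le_rpow hc (h i hi) hq0.le
    have h2 := Real.rpow_le_rpow (by positivity) h1 (inv_nonneg.2 hq0.le)
    rw [Real.mul_rpow (by positivity) (by positivity), Real.rpow_rpow_inv hc hq0.ne',
      Real.rpow_rpow_inv (lp.norm_nonneg' _) hq0.ne'] at h2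
    linarith

/-! ### Lattice sums -/

/-- The dyadic level of a lattice point. -/
noncomputable def dyadicLevel {d : ℕ} (k : Fin d → ℤ) : ℕ := Nat.log 2 ⌊‖k‖⌋₊

theorem one_le_norm_of_ne_zero {d : ℕ} {k : Fin d → ℤ} (hk : k ≠ 0) : 1 ≤ ‖k‖ := by
  obtain ⟨i, hi⟩ := Function.ne_iff.1 hk
  refine le_trans ?_ (norm_le_pi_norm k i)
  rw [Int.norm_eq_abs]
  exact_mod_cast Int.one_le_abs hi

theorem two_pow_dyadicLevel_le {d : ℕ} {k : Fin d → ℤ} (hk : k ≠ 0) :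
    (2 : ℝ) ^ dyadicLevel k ≤ ‖k‖ := by
  have h1 : ⌊‖k‖⌋₊ ≠ 0 := (Nat.floor_pos.2 (one_le_norm_of_ne_zero hk)).ne'
  refine le_trans ?_ (Nat.floor_le (norm_nonneg k))
  exact_mod_cast Nat.pow_log_le_self 2 h1

theorem norm_lt_two_pow_dyadicLevel {d : ℕ} (k : Fin d → ℤ) :
    ‖k‖ < 2 * (2 : ℝ) ^ dyadicLevel k := by
  refine (Nat.lt_floor_add_one ‖k‖).trans_le ?_
  have := Nat.lt_pow_succ_log_self (b := 2) (by norm_num) ⌊‖k‖⌋₊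
  rw [← pow_succ']
  exact_mod_cast this

theorem card_dyadicLevel_le {d : ℕ} (S : Finset (Fin d → ℤ)) (m : ℕ)
    (hS : ∀ k ∈ S, dyadicLevel k = m) : (S.card : ℝ) ≤ 8 ^ d * ((2 : ℝ) ^ m) ^ d := by
  have hsub : S ⊆ Fintype.piFinset fun _ : Fin d => Finset.Icc (-(2 * 2 ^ m : ℤ)) (2 * 2 ^ m) := by
    intro k hk
    rw [Fintype.mem_piFinset]
    intro i
    have h1 := (norm_le_pi_norm k i).trans (norm_lt_two_pow_dyadicLevel k).le
    rw [hS k hk, Int.norm_eq_abs] at h1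
    rw [Finset.mem_Icc, ← abs_le]
    exact_mod_cast h1
  have h2 := Finset.card_le_card hsub
  rw [Fintype.card_piFinset, Finset.prod_const, Finset.card_univ, Fintype.card_fin,
    Int.card_Icc] at h2
  have h3 : ((2 * 2 ^ m + 1 - -(2 * 2 ^ m) : ℤ)).toNat = 4 * 2 ^ m + 1 := by
    have : (2 * 2 ^ m + 1 - -(2 * 2 ^ m) : ℤ) = ((4 * 2 ^ m + 1 : ℕ) : ℤ) := by push_cast; ring
    rw [this, Int.toNat_natCast]
  rw [h3] at h2
  rw [← mul_pow]
  have h4 : (S.card : ℝ) ≤ (4 * 2 ^ m + 1) ^ d := by exact_mod_cast h2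
  refine h4.trans (pow_le_pow_left₀ (by positivity) ?_ _)
  have : (1 : ℝ) ≤ 2 ^ m := one_le_pow₀ (by norm_num)
  linarith

theorem summable_pow_natAbs {r : ℝ} (h0 : 0 ≤ r) (h1 : r < 1) :
    Summable fun i : ℤ => r ^ i.natAbs := by
  rw [summable_int_iff_summable_nat_and_neg]
  simpa using summable_geometric_of_lt_one h0 h1

/-- Above the cutoff j the minimum is 1 and the term decays at rate a; below it the term decays at
rate b - a. For 0 < a < b this is geometric decay in |m - j|. -/
theorem two_pow_rpow_mul_min_rpow_le (a b : ℝ) (m j : ℕ) :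
    ((2 : ℝ) ^ m) ^ (-a) * (min 1 ((2 : ℝ) ^ m / 2 ^ j)) ^ b ≤
      ((2 : ℝ) ^ j) ^ (-a) * ((2 : ℝ) ^ (-min a (b - a))) ^ ((m : ℤ) - j).natAbs := by
  have hpow : ∀ (n : ℕ) (x : ℝ), ((2 : ℝ) ^ n) ^ x = 2 ^ (n * x) := fun n x => by
    rw [← Real.rpow_natCast, ← Real.rpow_mul zero_le_two]
  have hpow' : ∀ (n : ℕ) (x : ℝ), ((2 : ℝ) ^ x) ^ n = 2 ^ (n * x) := fun n x => by
    rw [← Real.rpow_natCast, ← Real.rpow_mul zero_le_two, mul_comm]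
  have hdiv : (2 : ℝ) ^ m / 2 ^ j = 2 ^ ((m : ℝ) - j) := by
    rw [Real.rpow_sub zero_lt_two, Real.rpow_natCast, Real.rpow_natCast]
  rw [hpow, hpow, hpow']
  rcases le_total j m with h | h
  · have hn : ((((m : ℤ) - j).natAbs : ℕ) : ℝ) = m - j := by
      rw [show ((m : ℤ) - j).natAbs = m - j by omega, Nat.cast_sub h]
    have h' : (j : ℝ) ≤ m := by exact_mod_cast h
    rw [min_eq_left (by rw [hdiv]; exact Real.one_le_rpow one_le_two (by linarith)),
      Real.one_rpow, mul_one, hn, ← Real.rpow_add zero_lt_two]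
    refine Real.rpow_le_rpow_of_exponent_le one_le_two ?_
    have := mul_le_mul_of_nonneg_left (min_le_left a (b - a)) (sub_nonneg.2 h')
    linarith
  · have hn : ((((m : ℤ) - j).natAbs : ℕ) : ℝ) = j - m := by
      rw [show ((m : ℤ) - j).natAbs = j - m by omega, Nat.cast_sub h]
    have h' : (m : ℝ) ≤ j := by exact_mod_cast h
    have h1 : (2 : ℝ) ^ m / 2 ^ j ≤ 1 := by
      rw [hdiv]
      exact Real.rpow_le_one_of_one_le_of_nonpos one_le_two (sub_nonpos.2 h')
    rw [min_eq_right h1, hdiv, ← Real.rpow_mul zero_le_two, hn, ← Real.rpow_add zero_lt_two,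
      ← Real.rpow_add zero_lt_two]
    refine Real.rpow_le_rpow_of_exponent_le one_le_two ?_
    have := mul_le_mul_of_nonneg_left (min_le_right a (b - a)) (sub_nonneg.2 h')
    linarith

/-- A lattice sum that is truncated at frequency `2 ^ j` scales as the corresponding integral. -/
theorem exists_sum_rpow_mul_min_le (d : ℕ) {s τ : ℝ} (hs : (d : ℝ) / 2 < s) (hτ : s - d / 2 < τ)
    (hτ1 : τ ≤ 1) :
    ∃ C : ℝ, 0 ≤ C ∧ ∀ (j : ℕ) (S : Finset (Fin d → ℤ)),
      ∑ k ∈ S, ‖k‖ ^ (-(2 * s)) * (min 1 (‖k‖ / 2 ^ j)) ^ (2 * τ) ≤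
        C * ((2 : ℝ) ^ j) ^ (-(2 * s - d)) := by
  have ha : 0 < 2 * s - d := by linarith
  have hab : 2 * s - d < 2 * τ := by linarith
  -- Level m has about 2^(md) points, which turns 2^(-2sm) into 2^(-(2s-d)m). The conditions 2s - d
  -- > 0 and 2τ > 2s - d make the levels on either side of j decay geometrically.
  set r : ℝ := (2 : ℝ) ^ (-min (2 * s - d) (2 * τ - (2 * s - d))) with hr
  have hr0 : 0 ≤ r := by positivity
  have hr1 : r < 1 := Real.rpow_lt_one_of_one_lt_of_neg one_lt_two
    (neg_neg_of_pos (lt_min ha (by linarith)))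
  have hsum := summable_pow_natAbs hr0 hr1
  refine ⟨4 * 8 ^ d * ∑' i : ℤ, r ^ i.natAbs,
    mul_nonneg (by positivity) (tsum_nonneg fun i => by positivity), fun j S => ?_⟩
  have hterm : ∀ k : Fin d → ℤ, ‖k‖ ^ (-(2 * s)) * (min 1 (‖k‖ / 2 ^ j)) ^ (2 * τ) ≤
      4 * (((2 : ℝ) ^ dyadicLevel k) ^ (-(2 * s)) *
        (min 1 ((2 : ℝ) ^ dyadicLevel k / 2 ^ j)) ^ (2 * τ)) := by
    intro k
    rcases eq_or_ne k 0 with rfl | hk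
    -- At k = 0 the convention that 0 to a nonzero power is 0 removes the negative power.
    · rw [norm_zero, zero_div, min_eq_right zero_le_one, Real.zero_rpow (by linarith), zero_mul]
      positivity
    have h1 := two_pow_dyadicLevel_le hk
    have h2 := norm_lt_two_pow_dyadicLevel k
    set x : ℝ := (2 : ℝ) ^ dyadicLevel k
    have hx : 0 < x := by positivity
    have h3 : ‖k‖ ^ (-(2 * s)) ≤ x ^ (-(2 * s)) :=
      Real.rpow_le_rpow_of_nonpos hx h1 (by have := Nat.cast_nonneg (α := ℝ) d; linarith)
    have h4 : min 1 (‖k‖ / 2 ^ j) ≤ 2 * min 1 (x / 2 ^ j) := by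
      rw [mul_min_of_nonneg _ _ zero_le_two, ← mul_div_assoc]
      exact min_le_min (by norm_num) (by gcongr)
    -- Replacing |k| by its dyadic level costs a factor 2 in the minimum, hence 2^(2τ) ≤ 4 as τ ≤ 1.
    have h5 : (min 1 (‖k‖ / 2 ^ j)) ^ (2 * τ) ≤ 4 * (min 1 (x / 2 ^ j)) ^ (2 * τ) := by
      refine (Real.rpow_le_rpow (by positivity) h4 (by linarith)).trans ?_
      rw [Real.mul_rpow zero_le_two (by positivity)]
      refine mul_le_mul_of_nonneg_right ?_ (by positivity)
      refine (Real.rpow_le_rpow_of_exponent_le one_le_two (by linarith : 2 * τ ≤ 2)).trans ?_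
      norm_num
    calc _ ≤ x ^ (-(2 * s)) * (4 * (min 1 (x / 2 ^ j)) ^ (2 * τ)) :=
          mul_le_mul h3 h5 (by positivity) (by positivity)
      _ = _ := by ring
  have hmaps : ∀ k ∈ S, dyadicLevel k ∈ S.image dyadicLevel := fun k hk =>
    Finset.mem_image_of_mem _ hk
  rw [← Finset.sum_fiberwise_of_maps_to hmaps]
  have hlevel : ∀ m ∈ S.image dyadicLevel,
      ∑ k ∈ S with dyadicLevel k = m, ‖k‖ ^ (-(2 * s)) * (min 1 (‖k‖ / 2 ^ j)) ^ (2 * τ) ≤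
        4 * 8 ^ d * ((2 : ℝ) ^ j) ^ (-(2 * s - d)) * r ^ ((m : ℤ) - j).natAbs := by
    intro m _
    have h1 := Finset.sum_le_card_nsmul (S.filter fun k => dyadicLevel k = m)
      (fun k => ‖k‖ ^ (-(2 * s)) * (min 1 (‖k‖ / 2 ^ j)) ^ (2 * τ))
      (4 * (((2 : ℝ) ^ m) ^ (-(2 * s)) * (min 1 ((2 : ℝ) ^ m / 2 ^ j)) ^ (2 * τ)))
      (fun k hk => by
        have := hterm k
        rwa [(Finset.mem_filter.1 hk).2] at this)
    rw [nsmul_eq_mul] at h1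
    refine h1.trans ?_
    refine (mul_le_mul_of_nonneg_right (card_dyadicLevel_le _ m fun k hk =>
      (Finset.mem_filter.1 hk).2) (by positivity)).trans ?_
    have h2 := two_pow_rpow_mul_min_rpow_le (2 * s - d) (2 * τ) m j
    have h3 : ((2 : ℝ) ^ m) ^ (-(2 * s - d)) = ((2 : ℝ) ^ m) ^ d * ((2 : ℝ) ^ m) ^ (-(2 * s)) := by
      rw [← Real.rpow_natCast ((2 : ℝ) ^ m) d, ← Real.rpow_add (by positivity)]
      congr 1; ring
    rw [h3] at h2
    calc _ = 4 * 8 ^ d * (((2 : ℝ) ^ m) ^ d * ((2 : ℝ) ^ m) ^ (-(2 * s)) *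
          (min 1 ((2 : ℝ) ^ m / 2 ^ j)) ^ (2 * τ)) := by ring
      _ ≤ 4 * 8 ^ d * (((2 : ℝ) ^ j) ^ (-(2 * s - d)) * r ^ ((m : ℤ) - j).natAbs) :=
          mul_le_mul_of_nonneg_left h2 (by positivity)
      _ = _ := by ring
  refine (Finset.sum_le_sum hlevel).trans ?_
  rw [← Finset.mul_sum]
  have h6 : ∑ m ∈ S.image dyadicLevel, r ^ ((m : ℤ) - j).natAbs ≤ ∑' i : ℤ, r ^ i.natAbs := by
    have hinj : Function.Injective fun m : ℕ => (m : ℤ) - j := fun a b h => by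
      simpa using h
    have := hsum.sum_le_tsum ((S.image dyadicLevel).map ⟨_, hinj⟩) fun i _ => by positivity
    rwa [Finset.sum_map] at this
  calc _ ≤ 4 * 8 ^ d * ((2 : ℝ) ^ j) ^ (-(2 * s - d)) * ∑' i : ℤ, r ^ i.natAbs :=
        mul_le_mul_of_nonneg_left h6 (by positivity)
    _ = _ := by ring

/-! ### Decay of a Sobolev function at a zero -/

/-- A continuous function in the Sobolev space of order `s` on the torus, where
`d / 2 < s < d / 2 + 1`, is of size `o(r ^ (s - d / 2))` at distance `r` from a zero. -/
theorem exists_tendsto_bound_near_zero {d : ℕ} {s : ℝ} (hs : (d : ℝ) / 2 < s)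
    (hs1 : s < (d : ℝ) / 2 + 1) {g : UnitAddTorus (Fin d) → ℂ} (hg : Continuous g)
    (hsum : Summable fun k : Fin d → ℤ => ‖k‖ ^ (2 * s) * ‖UnitAddTorus.mFourierCoeff g k‖ ^ 2)
    {x₀ : UnitAddTorus (Fin d)} (hx₀ : g x₀ = 0) :
    ∃ ε : ℕ → ℝ, Filter.Tendsto ε Filter.atTop (nhds 0) ∧ ∀ j : ℕ, 0 ≤ ε j ∧
      ∀ x, d * dist x x₀ ≤ 1 / (16 * 2 ^ j) →
        ‖g x‖ ≤ ε j * ((2 : ℝ) ^ j) ^ (-(s - d / 2)) := by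
  -- The factor min(1, |k|/2^j) is split into its powers 1 - τ and τ. The first goes with the
  -- Sobolev weight into P, whose sum tends to 0 by dominated convergence because τ < 1; the second
  -- goes into Q, whose sum has the right scaling because τ > s - d/2.
  obtain ⟨τ, hτ, hτ1⟩ := exists_between (show s - (d : ℝ) / 2 < 1 by linarith)
  have hτ0 : 0 < τ := by linarith
  have hs0 : 0 < s := by have := Nat.cast_nonneg (α := ℝ) d; linarith
  obtain ⟨C, hC0, hC⟩ := exists_sum_rpow_mul_min_le d hs hτ hτ1.le
  set A : (Fin d → ℤ) → ℝ := fun k => ‖k‖ ^ (2 * s) * ‖UnitAddTorus.mFourierCoeff g k‖ ^ 2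
    with hA
  have hA0 : ∀ k, 0 ≤ A k := fun k => by positivity
  set μ : ℕ → (Fin d → ℤ) → ℝ := fun j k => min 1 (‖k‖ / 2 ^ j) with hμ
  have hμ0 : ∀ j k, 0 ≤ μ j k := fun j k => by positivity
  have hμ1 : ∀ j k, μ j k ≤ 1 := fun j k => min_le_left _ _
  set P : ℕ → (Fin d → ℤ) → ℝ := fun j k => A k * μ j k ^ (2 * (1 - τ)) with hP
  have hP0 : ∀ j k, 0 ≤ P j k := fun j k => mul_nonneg (hA0 k) (Real.rpow_nonneg (hμ0 j k) _)
  have hPA : ∀ j k, P j k ≤ A k := fun j k =>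
    mul_le_of_le_one_right (hA0 k) (Real.rpow_le_one (hμ0 j k) (hμ1 j k) (by linarith))
  have hPs : ∀ j, Summable (P j) := fun j => hsum.of_nonneg_of_le (hP0 j) (hPA j)
  set Q : ℕ → (Fin d → ℤ) → ℝ := fun j k => ‖k‖ ^ (-(2 * s)) * μ j k ^ (2 * τ) with hQ
  have hQ0 : ∀ j k, 0 ≤ Q j k := fun j k =>
    mul_nonneg (by positivity) (Real.rpow_nonneg (hμ0 j k) _)
  have hQs : ∀ j, Summable (Q j) := fun j => summable_of_sum_le (hQ0 j) (hC j)
  have hQC : ∀ j, ∑' k, Q j k ≤ C * ((2 : ℝ) ^ j) ^ (-(2 * s - d)) := fun j =>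
    Real.tsum_le_of_sum_le (hQ0 j) (hC j)
  have hprod : ∀ j k, ‖UnitAddTorus.mFourierCoeff g k‖ * μ j k = √(P j k) * √(Q j k) := by
    intro j k
    rw [← Real.sqrt_mul (hP0 j k)]
    refine (Real.sqrt_eq_iff_eq_sq ?_ ?_ |>.2 ?_).symm
    · exact mul_nonneg (hP0 j k) (hQ0 j k)
    · exact mul_nonneg (norm_nonneg _) (hμ0 j k)
    rcases eq_or_ne k 0 with rfl | hk
    · simp [hP, hQ, hμ, Real.zero_rpow (by linarith : 2 * τ ≠ 0)]
    have hk0 : 0 < ‖k‖ := norm_pos_iff.2 hk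
    have hμpos : 0 < μ j k := lt_min one_pos (by positivity)
    have h1 : ‖k‖ ^ (2 * s) * ‖k‖ ^ (-(2 * s)) = 1 := by
      rw [← Real.rpow_add hk0]; simp
    have h2 : μ j k ^ (2 * (1 - τ)) * μ j k ^ (2 * τ) = μ j k ^ 2 := by
      rw [← Real.rpow_add hμpos, ← Real.rpow_natCast]; congr 1; push_cast; ring
    calc P j k * Q j k = (‖k‖ ^ (2 * s) * ‖k‖ ^ (-(2 * s))) *
          ‖UnitAddTorus.mFourierCoeff g k‖ ^ 2 *
          (μ j k ^ (2 * (1 - τ)) * μ j k ^ (2 * τ)) := by simp only [hP, hQ, hA]; ring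
      _ = _ := by rw [h1, h2]; ring
  have hsq : ∀ (f : (Fin d → ℤ) → ℝ), (∀ k, 0 ≤ f k) → (fun k => √(f k) ^ (2 : ℝ)) = f :=
    fun f hf => funext fun k => by
      rw [Real.rpow_two, Real.sq_sqrt (hf k)]
  have hCS : ∀ j, (Summable fun k => ‖UnitAddTorus.mFourierCoeff g k‖ * μ j k) ∧
      ∑' k, ‖UnitAddTorus.mFourierCoeff g k‖ * μ j k ≤ √(∑' k, P j k) * √(∑' k, Q j k) := by
    intro j
    have := Real.summable_and_inner_le_Lp_mul_Lq_tsum_of_nonneg Real.HolderConjugate.two_two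
      (f := fun k => √(P j k)) (g := fun k => √(Q j k)) (fun k => Real.sqrt_nonneg _)
      (fun k => Real.sqrt_nonneg _) (by rw [hsq _ (hP0 j)]; exact hPs j)
      (by rw [hsq _ (hQ0 j)]; exact hQs j)
    simp only [hprod]
    rw [hsq _ (hP0 j), hsq _ (hQ0 j), ← Real.sqrt_eq_rpow, ← Real.sqrt_eq_rpow] at this
    exact this
  -- At j = 0 the minimum is 1 for every k ≠ 0, so the Cauchy–Schwarz bound already contains
  -- absolute convergence of the Fourier series.
  have hsumm : Summable (UnitAddTorus.mFourierCoeff g) := by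
    refine Summable.of_norm ?_
    have h0 : Summable fun k : Fin d → ℤ =>
        if k = 0 then ‖UnitAddTorus.mFourierCoeff g k‖ else 0 :=
      summable_of_ne_finset_zero (s := {0}) fun k hk => by
        rw [if_neg (by simpa using hk)]
    refine (h0.add (hCS 0).1).of_nonneg_of_le (fun k => norm_nonneg _) fun k => ?_
    rcases eq_or_ne k 0 with rfl | hk
    · simp [hμ]
    · have : μ 0 k = 1 := by
        simp only [hμ, pow_zero, div_one]
        exact min_eq_left (one_le_norm_of_ne_zero hk)
      simp [hk, this]
  have hseries := UnitAddTorus.hasSum_mFourier_series_apply_of_summable (f := ⟨g, hg⟩) hsumm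
  have hlim : Filter.Tendsto (fun j => ∑' k, P j k) Filter.atTop (nhds 0) := by
    have h1 : Filter.Tendsto (fun j => ∑' k, P j k) Filter.atTop
        (nhds (∑' _ : Fin d → ℤ, (0 : ℝ))) := by
      refine tendsto_tsum_of_dominated_convergence hsum (fun k => ?_)
        (.of_forall fun j k => by rw [Real.norm_of_nonneg (hP0 j k)]; exact hPA j k)
      have h2 : Filter.Tendsto (fun j => μ j k) Filter.atTop (nhds 0) := by
        have h3 : Filter.Tendsto (fun j : ℕ => ‖k‖ / (2 : ℝ) ^ j) Filter.atTop (nhds 0) :=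
          tendsto_const_nhds.div_atTop (tendsto_pow_atTop_atTop_of_one_lt one_lt_two)
        exact squeeze_zero (fun j => hμ0 j k) (fun j => min_le_right _ _) h3
      have h4 := (h2.rpow_const (p := 2 * (1 - τ)) (Or.inr (by linarith))).const_mul (A k)
      rwa [Real.zero_rpow (by linarith), mul_zero] at h4
    rwa [tsum_zero] at h1
  refine ⟨fun j => 2 * √C * √(∑' k, P j k), ?_, fun j => ⟨by positivity, fun x hx => ?_⟩⟩
  · have h1 := (Real.continuous_sqrt.tendsto 0).comp hlim
    rw [Real.sqrt_zero] at h1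
    simpa using h1.const_mul (2 * √C)
  · have h1 : HasSum (fun k => UnitAddTorus.mFourierCoeff g k •
        (UnitAddTorus.mFourier k x - UnitAddTorus.mFourier k x₀)) (g x) := by
      have := (hseries x).sub (hseries x₀)
      simp only [ContinuousMap.coe_mk, hx₀, sub_zero] at this
      simpa only [smul_sub] using this
    have h2 : ‖g x‖ ≤ ∑' k, 2 * (‖UnitAddTorus.mFourierCoeff g k‖ * μ j k) := by
      rw [← h1.tsum_eq]
      refine tsum_of_norm_bounded ((hCS j).1.mul_left 2).hasSum fun k => ?_
      rw [norm_smul]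
      have := mul_le_mul_of_nonneg_left (norm_mFourier_sub_mFourier_le_two_mul_min
        (N := 2 ^ j) (by positivity) k hx) (norm_nonneg (UnitAddTorus.mFourierCoeff g k))
      linarith
    rw [tsum_mul_left] at h2
    have h3 : √(∑' k, Q j k) ≤ √C * ((2 : ℝ) ^ j) ^ (-(s - d / 2)) := by
      refine (Real.sqrt_le_sqrt (hQC j)).trans (le_of_eq ?_)
      rw [Real.sqrt_mul hC0, Real.sqrt_eq_rpow (_ ^ _), ← Real.rpow_mul (by positivity)]
      congr 2
      ring
    have h4 := mul_le_mul_of_nonneg_left h3 (Real.sqrt_nonneg (∑' k, P j k))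
    have h5 := (hCS j).2
    linarith

/-! ### Reciprocals that are not multipliers -/

theorem norm_fourierSeq_indicator_le {d : ℕ} {w g : UnitAddTorus (Fin d) → ℂ}
    (hgw : g =ᵐ[torusMeasure d] w) {x₀ : UnitAddTorus (Fin d)} {ρ M : ℝ} (h0 : 0 ≤ ρ)
    (hρ : 2 * ρ ≤ 1) (hM : 0 ≤ M) (hg : ∀ x ∈ Metric.closedBall x₀ ρ, ‖g x‖ ≤ M)
    (hf : MemLp ((Metric.closedBall x₀ ρ).indicator w) 2 (torusMeasure d)) :
    ‖fourierSeq hf‖ ≤ √((2 * ρ) ^ d) * M := by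
  have hBm : MeasurableSet (Metric.closedBall x₀ ρ) := Metric.isClosed_closedBall.measurableSet
  have hV : 0 ≤ (2 * ρ) ^ d := by positivity
  have h1 : eLpNorm ((Metric.closedBall x₀ ρ).indicator w) 2 (torusMeasure d) ≤
      ENNReal.ofReal (√((2 * ρ) ^ d) * M) := by
    rw [eLpNorm_indicator_eq_eLpNorm_restrict hBm]
    have h2 : ∀ᵐ x ∂(torusMeasure d).restrict (Metric.closedBall x₀ ρ), ‖w x‖ ≤ M := by
      rw [ae_restrict_iff' hBm]
      filter_upwards [hgw] with x hx hxB
      rw [← hx]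
      exact hg x hxB
    refine (eLpNorm_le_of_ae_bound h2).trans (le_of_eq ?_)
    rw [Measure.restrict_apply_univ, torusMeasure_closedBall x₀ h0 hρ,
      ENNReal.ofReal_rpow_of_nonneg hV (by simp), ← ENNReal.ofReal_mul (by positivity),
      Real.sqrt_eq_rpow]
    norm_num
  rw [norm_fourierSeq]
  exact ENNReal.toReal_le_of_le_ofReal (by positivity) h1

/-- The hypothesis `hdq` is q ≤ d/(d-s) in a form that also covers q = ∞ and s ≥ d. -/
theorem not_recipIsTwoMultiplier_of_hasZero {d : ℕ} (hd : 1 ≤ d) {s : ℝ} (hs : (d : ℝ) / 2 < s)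
    (hs1 : s < (d : ℝ) / 2 + 1) {w : UnitAddTorus (Fin d) → ℂ} (hw : MemSobolevTorus d s w)
    (hz : HasZeroTorus d w) {q : ℝ≥0∞} (hq : q ≠ 0) (hdq : (d : ℝ) - s ≤ d * q.toReal⁻¹) :
    ¬ RecipIsTwoMultiplier d q w := by
  rintro ⟨hw0, -, C, hC⟩
  obtain ⟨g, hg, hgw, x₀, hx₀⟩ := hz
  have hd0 : (0 : ℝ) < d := by exact_mod_cast hd
  have hd1 : (1 : ℝ) ≤ d := by exact_mod_cast hd
  -- Here `‖k‖` is the sup norm, which is dominated by the Euclidean norm of the definition.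
  have hsum : Summable fun k : Fin d → ℤ =>
      ‖k‖ ^ (2 * s) * ‖UnitAddTorus.mFourierCoeff g k‖ ^ 2 := by
    refine hw.2.of_nonneg_of_le (fun k => by positivity) fun k => ?_
    rw [mFourierCoeff_congr_ae hgw]
    refine mul_le_mul_of_nonneg_right (Real.rpow_le_rpow (norm_nonneg _) ?_ (by linarith))
      (by positivity)
    refine (pi_norm_le_iff_of_nonneg (norm_nonneg _)).2 fun i => ?_
    have := PiLp.norm_apply_le (WithLp.toLp 2 fun i => (k i : ℝ)) i
    simpa [Int.norm_eq_abs] using this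
  obtain ⟨ε, hε, hbound⟩ := exists_tendsto_bound_near_zero hs hs1 hg hsum hx₀
  -- The lower bound (8d)^(-d) is V·N^d, independent of j, which contradicts ε j → 0.
  have key : ∀ j : ℕ, ((8 * d : ℝ) ^ d)⁻¹ ≤ (2 * |C| * ε j) ^ 2 := by
    intro j
    set N : ℝ := 2 ^ j with hN
    have hN1 : 1 ≤ N := one_le_pow₀ one_le_two
    have hN0 : 0 < N := by positivity
    -- This makes dρ = 1/(16N), the largest radius admitted both by the decay estimate and by the
    -- bound for the indicator function.
    set ρ : ℝ := 1 / (16 * d * N) with hρdef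
    have hρ0 : 0 < ρ := by positivity
    have hdρ : d * ρ ≤ 1 / (16 * N) := by
      rw [hρdef]; apply le_of_eq; field_simp
    have h2ρ : 2 * ρ = (8 * d * N)⁻¹ := by rw [hρdef]; field_simp; norm_num
    have hρ1 : 2 * ρ ≤ 1 := by
      rw [h2ρ]
      refine inv_le_one_of_one_le₀ ?_
      nlinarith [mul_le_mul hd1 hN1 zero_le_one hd0.le]
    set B := Metric.closedBall x₀ ρ
    have hBm : MeasurableSet B := Metric.isClosed_closedBall.measurableSet
    have hf : MemLp (B.indicator w) 2 (torusMeasure d) := hw.1.indicator hBm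
    set V : ℝ := (2 * ρ) ^ d with hV
    have hV0 : 0 < V := by positivity
    have hfn := norm_fourierSeq_indicator_le hgw hρ0.le hρ1
      (M := ε j * N ^ (-(s - d / 2))) (mul_nonneg (hbound j).1 (by positivity))
      (fun x hx => (hbound j).2 x ((mul_le_mul_of_nonneg_left hx hd0.le).trans hdρ)) hf
    obtain ⟨hmem, hle⟩ := hC (fourierSeq hf)
    have hcoeff : multiplierSeq d (fun x => 1 / w x) (fourierSeq hf) =
        UnitAddTorus.mFourierCoeff (B.indicator fun _ => (1 : ℂ)) := by
      rw [multiplierSeq_fourierSeq]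
      refine mFourierCoeff_congr_ae ?_
      filter_upwards [hw0] with x hx
      by_cases hxB : x ∈ B <;> simp [hxB, hx]
    set S : Finset (Fin d → ℤ) := Fintype.piFinset fun _ => Finset.Icc (0 : ℤ) (2 ^ j)
    have hScard : N ^ d ≤ (S.card : ℝ) := by
      have : S.card = (2 ^ j + 1) ^ d := by
        rw [Fintype.card_piFinset, Finset.prod_const, Finset.card_univ, Fintype.card_fin,
          Int.card_Icc]
        have : (2 ^ j + 1 - 0 : ℤ) = ((2 ^ j + 1 : ℕ) : ℤ) := by push_cast; ring
        rw [this, Int.toNat_natCast]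
      rw [this]
      push_cast
      exact pow_le_pow_left₀ hN0.le (by linarith) d
    have hSne : S.Nonempty := by
      rw [← Finset.card_pos]
      have : (0 : ℝ) < S.card := lt_of_lt_of_le (by positivity) hScard
      exact_mod_cast this
    have hlow := card_mul_le_lp_norm hq
      (⟨multiplierSeq d (fun x => 1 / w x) (fourierSeq hf), hmem⟩ :
        lp (fun _ : Fin d → ℤ => ℂ) q) hSne (c := V / 2) (by positivity) (fun k hk => by
          rw [show ((⟨multiplierSeq d (fun x => 1 / w x) (fourierSeq hf), hmem⟩ :
            lp (fun _ : Fin d → ℤ => ℂ) q) : (Fin d → ℤ) → ℂ) k =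
              UnitAddTorus.mFourierCoeff (B.indicator fun _ => (1 : ℂ)) k from congrFun hcoeff k]
          refine le_norm_mFourierCoeff_indicator hN1 hρ0.le hρ1 hdρ x₀ ?_
          rw [Fintype.mem_piFinset] at hk
          refine (pi_norm_le_iff_of_nonneg hN0.le).2 fun i => ?_
          have := Finset.mem_Icc.1 (hk i)
          rw [Int.norm_eq_abs, abs_of_nonneg (by exact_mod_cast this.1)]
          rw [hN]
          exact_mod_cast this.2)
    have h1 : V / 2 * (N ^ d) ^ q.toReal⁻¹ ≤ |C| * (√V * (ε j * N ^ (-(s - d / 2)))) := by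
      calc V / 2 * (N ^ d) ^ q.toReal⁻¹ ≤ V / 2 * (S.card : ℝ) ^ q.toReal⁻¹ := by
            refine mul_le_mul_of_nonneg_left ?_ (by positivity)
            exact Real.rpow_le_rpow (by positivity) hScard (by positivity)
        _ ≤ C * ‖fourierSeq hf‖ := hlow.trans hle
        _ ≤ |C| * ‖fourierSeq hf‖ := mul_le_mul_of_nonneg_right (le_abs_self C) (norm_nonneg _)
        _ ≤ _ := mul_le_mul_of_nonneg_left hfn (abs_nonneg C)
    have hsq : √V * √V = V := Real.mul_self_sqrt hV0.le
    have hsV : 0 < √V := Real.sqrt_pos.2 hV0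
    have h2 : √V * (N ^ d) ^ q.toReal⁻¹ ≤ 2 * |C| * ε j * N ^ (-(s - d / 2)) := by
      refine le_of_mul_le_mul_left ?_ hsV
      rw [← mul_assoc, hsq]
      linarith
    have h3 : √V * N ^ ((d : ℝ) / 2) ≤ 2 * |C| * ε j := by
      -- This is where d - s ≤ d/q enters, as d/2 ≤ d/q + s - d/2.
      have h4 : N ^ ((d : ℝ) / 2) ≤ (N ^ d) ^ q.toReal⁻¹ * N ^ (s - d / 2) := by
        rw [← Real.rpow_natCast N d, ← Real.rpow_mul hN0.le, ← Real.rpow_add hN0]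
        exact Real.rpow_le_rpow_of_exponent_le hN1 (by linarith)
      have h5 : N ^ (-(s - d / 2)) * N ^ (s - d / 2) = 1 := by
        rw [← Real.rpow_add hN0]; simp
      calc √V * N ^ ((d : ℝ) / 2) ≤ √V * ((N ^ d) ^ q.toReal⁻¹ * N ^ (s - d / 2)) := by gcongr
        _ = (√V * (N ^ d) ^ q.toReal⁻¹) * N ^ (s - d / 2) := by ring
        _ ≤ (2 * |C| * ε j * N ^ (-(s - d / 2))) * N ^ (s - d / 2) := by gcongr
        _ = 2 * |C| * ε j * (N ^ (-(s - d / 2)) * N ^ (s - d / 2)) := by ring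
        _ = _ := by rw [h5, mul_one]
    have h6 : (√V * N ^ ((d : ℝ) / 2)) ^ 2 = ((8 * d : ℝ) ^ d)⁻¹ := by
      have h7 : (N ^ ((d : ℝ) / 2)) ^ 2 = N ^ d := by
        rw [← Real.rpow_natCast, ← Real.rpow_mul hN0.le, ← Real.rpow_natCast N d]
        congr 1; push_cast; ring
      rw [mul_pow, Real.sq_sqrt hV0.le, h7, hV, h2ρ, ← mul_pow, ← inv_pow]
      congr 1
      field_simp
    rw [← h6]
    exact pow_le_pow_left₀ (by positivity) h3 2
  have hlim : Filter.Tendsto (fun j => (2 * |C| * ε j) ^ 2) Filter.atTop (nhds 0) := by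
    simpa using (hε.const_mul (2 * |C|)).pow 2
  have := ge_of_tendsto' hlim key
  have hpos : 0 < ((8 * d : ℝ) ^ d)⁻¹ := by positivity
  linarith

/-! ### Monotonicity in the order and conversion of the exponent conditions -/

theorem MemSobolevTorus.mono {d : ℕ} {s s' : ℝ} (hs' : 0 < s') (h : s' ≤ s)
    {w : UnitAddTorus (Fin d) → ℂ} (hw : MemSobolevTorus d s w) : MemSobolevTorus d s' w := by
  refine ⟨hw.1, hw.2.of_nonneg_of_le (fun k => by positivity) fun k => ?_⟩
  refine mul_le_mul_of_nonneg_right ?_ (by positivity)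
  rcases eq_or_ne k 0 with rfl | hk
  · have : (WithLp.toLp 2 fun i : Fin d => (((0 : Fin d → ℤ) i : ℤ) : ℝ)) = 0 := by
      ext i; simp
    rw [this, norm_zero, Real.zero_rpow (by linarith), Real.zero_rpow (by linarith)]
  · refine Real.rpow_le_rpow_of_exponent_le ((one_le_norm_of_ne_zero hk).trans ?_) (by linarith)
    refine (pi_norm_le_iff_of_nonneg (norm_nonneg _)).2 fun i => ?_
    have := PiLp.norm_apply_le (WithLp.toLp 2 fun i => (k i : ℝ)) i
    simpa [Int.norm_eq_abs] using this

theorem sub_le_mul_inv_toReal {d : ℕ} {s : ℝ} {q : ℝ≥0∞} (hq2 : 2 ≤ q)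
    (hq : q ≤ (d : ℝ≥0∞) / ENNReal.ofReal ((d : ℝ) - s)) : (d : ℝ) - s ≤ d * q.toReal⁻¹ := by
  -- If d ≤ s the quotient is ∞ and `hq` says nothing, but the claim is trivial.
  rcases le_or_gt ((d : ℝ) - s) 0 with h | h
  · exact h.trans (by positivity)
  have h1 : (d : ℝ≥0∞) / ENNReal.ofReal ((d : ℝ) - s) = ENNReal.ofReal (d / (d - s)) := by
    rw [ENNReal.ofReal_div_of_pos h, ENNReal.ofReal_natCast]
  rw [h1] at hq
  have hqt : q ≠ ∞ := (hq.trans_lt ENNReal.ofReal_lt_top).ne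
  have hq0 : 0 < q.toReal := ENNReal.toReal_pos (by positivity) hqt
  have h2 := ENNReal.toReal_le_of_le_ofReal (by positivity) hq
  rw [le_div_iff₀ h] at h2
  rw [← div_eq_mul_inv, le_div_iff₀ hq0]
  linarith

/-- The bound 2d/(d-2) is d/(d-s) at s = d/2 + 1; as it is strict, some order below d/2 + 1 still
satisfies the non-strict condition. -/
theorem exists_smaller_order {d : ℕ} (hd : 1 ≤ d) {q : ℝ≥0∞} (hq2 : 2 ≤ q)
    (hq : q < (2 * d : ℝ≥0∞) / ENNReal.ofReal ((d : ℝ) - 2)) :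
    ∃ s' : ℝ, (d : ℝ) / 2 < s' ∧ s' < (d : ℝ) / 2 + 1 ∧ (d : ℝ) - s' ≤ d * q.toReal⁻¹ := by
  suffices h : (d : ℝ) / 2 - 1 < d * q.toReal⁻¹ by
    obtain ⟨t, ht1, ht2⟩ := exists_between (lt_min h (show (d : ℝ) / 2 - 1 < d / 2 by linarith))
    exact ⟨d - t, by linarith [lt_min_iff.1 ht2], by linarith, by linarith [lt_min_iff.1 ht2]⟩
  have hd0 : (0 : ℝ) < d := by exact_mod_cast hd
  have hqt : q ≠ ∞ := (lt_of_lt_of_le hq le_top).ne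
  have hq0 : 0 < q.toReal := ENNReal.toReal_pos (by positivity) hqt
  -- For d ≤ 2 the quotient is ∞ and only the finiteness of q is used.
  rcases le_or_gt ((d : ℝ) - 2) 0 with h | h
  · have : 0 < d * q.toReal⁻¹ := by positivity
    linarith
  have h1 : (2 * d : ℝ≥0∞) / ENNReal.ofReal ((d : ℝ) - 2) = ENNReal.ofReal (2 * d / (d - 2)) := by
    rw [ENNReal.ofReal_div_of_pos h, ENNReal.ofReal_mul zero_le_two, ENNReal.ofReal_natCast,
      ENNReal.ofReal_ofNat]
  rw [h1, ENNReal.lt_ofReal_iff_toReal_lt hqt, lt_div_iff₀ h] at hq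
  rw [← div_eq_mul_inv, lt_div_iff₀ hq0]
  linarith

/-! ### The binomial series -/

theorem multichoose_succ_mul (γ : ℝ) (n : ℕ) :
    (n + 1 : ℝ) * Ring.multichoose γ (n + 1) = (γ + n) * Ring.multichoose γ n := by
  have h1 := Ring.factorial_nsmul_multichoose_eq_ascPochhammer γ (n + 1)
  have h2 := Ring.factorial_nsmul_multichoose_eq_ascPochhammer γ n
  rw [Polynomial.ascPochhammer_smeval_eq_eval, nsmul_eq_mul] at h1 h2
  rw [ascPochhammer_succ_eval, ← h2, Nat.factorial_succ] at h1
  have h3 : (n.factorial : ℝ) ≠ 0 := by positivity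
  apply mul_left_cancel₀ h3
  push_cast at h1
  linarith

theorem hasSum_multichoose_mul_pow (γ : ℝ) {z : ℝ} (hz : |z| < 1) :
    HasSum (fun n => Ring.multichoose γ n * z ^ n) ((1 - z) ^ (-γ)) := by
  have h := (Real.one_div_one_sub_rpow_hasFPowerSeriesOnBall_zero γ).hasSum (y := z)
    (by simpa [enorm_eq_nnnorm, ← NNReal.coe_lt_one] using hz)
  have hz' : 0 ≤ 1 - z := by linarith [(abs_lt.1 hz).2]
  rw [zero_add, one_div, ← Real.rpow_neg hz'] at h
  refine h.congr_fun fun n => ?_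
  rw [FormalMultilinearSeries.ofScalars_apply_eq, smul_eq_mul, Ring.multichoose_eq]

theorem one_add_mul_le_one_add_rpow_of_nonpos {x p : ℝ} (hx : 0 ≤ x) (hp : p ≤ 0) :
    1 + p * x ≤ (1 + x) ^ p := by
  rw [Real.rpow_def_of_pos (by linarith)]
  have h1 := Real.add_one_le_exp (Real.log (1 + x) * p)
  have h2 := Real.log_le_sub_one_of_pos (show 0 < 1 + x by linarith)
  nlinarith

/-- Consecutive coefficients have ratio 1 + (γ-1)/(n+1) ≤ ((n+2)/(n+1))^(γ-1), by a Bernoulli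
inequality. The first ratio is γ, possibly negative, and is treated apart: |γ| ≤ 1 ≤ 4·2^(γ-1),
whence the constant 4. -/
theorem abs_multichoose_le {γ : ℝ} (h0 : -1 < γ) (h1 : γ < 1) (n : ℕ) :
    |Ring.multichoose γ n| ≤ 4 * ((n : ℝ) + 1) ^ (γ - 1) := by
  induction n with
  | zero => simp
  | succ n ih =>
    have hrec := multichoose_succ_mul γ n
    rcases Nat.eq_zero_or_pos n with rfl | hn
    · simp only [Nat.cast_zero, zero_add, one_mul, Ring.multichoose_zero_right, mul_one,
        add_zero, Nat.cast_one] at hrec ⊢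
      rw [hrec]
      have h2 : (2 : ℝ) ^ (-2 : ℝ) ≤ 2 ^ (γ - 1) :=
        Real.rpow_le_rpow_of_exponent_le one_le_two (by linarith)
      have h3 : (2 : ℝ) ^ (-2 : ℝ) = 1 / 4 := by
        rw [Real.rpow_neg zero_le_two, Real.rpow_two]; norm_num
      have h4 : |γ| ≤ 1 := abs_le.2 ⟨h0.le, h1.le⟩
      norm_num at *
      linarith
    · have hn1 : (1 : ℝ) ≤ n := by exact_mod_cast hn
      have hn0 : (0 : ℝ) < n + 1 := by linarith
      have h2 : Ring.multichoose γ (n + 1) =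
          (1 + (γ - 1) * (1 / (n + 1))) * Ring.multichoose γ n := by
        field_simp
        linarith
      have h3 := one_add_mul_le_one_add_rpow_of_nonpos (x := 1 / ((n : ℝ) + 1)) (p := γ - 1)
        (by positivity) (by linarith)
      have h4 : 0 ≤ 1 + (γ - 1) * (1 / ((n : ℝ) + 1)) := by
        have : 1 + (γ - 1) * (1 / ((n : ℝ) + 1)) = (n + γ) / (n + 1) := by field_simp; ring
        rw [this]
        exact div_nonneg (by linarith) hn0.le
      rw [h2, abs_mul, abs_of_nonneg h4]
      refine (mul_le_mul h3 ih (abs_nonneg _) (by positivity)).trans (le_of_eq ?_)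
      rw [mul_left_comm, ← Real.mul_rpow (by positivity) hn0.le]
      congr 2
      push_cast
      field_simp

/-! ### Powers of a product of squared cosines -/

/-- The function `cos² (π t)` on the circle. -/
noncomputable def cosSq (t : UnitAddCircle) : ℝ := (1 + (fourier 1 t : ℂ).re) / 2

/-- The Fourier coefficients of `cosSq ^ n`. -/
noncomputable def cosSqCoeff (n : ℕ) (m : ℤ) : ℝ := ((2 * n).choose (n + m.natAbs) : ℝ) / 4 ^ n

theorem abs_re_fourier_le (t : UnitAddCircle) : |(fourier 1 t : ℂ).re| ≤ 1 :=
  (Complex.abs_re_le_norm _).trans (by rw [fourier_apply, Circle.norm_coe])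

theorem cosSq_nonneg (t : UnitAddCircle) : 0 ≤ cosSq t := by
  have := (abs_le.1 (abs_re_fourier_le t)).1
  unfold cosSq; linarith

theorem cosSq_le_one (t : UnitAddCircle) : cosSq t ≤ 1 := by
  have := (abs_le.1 (abs_re_fourier_le t)).2
  unfold cosSq; linarith

theorem continuous_cosSq : Continuous cosSq := by
  unfold cosSq; fun_prop

theorem cosSq_zero : cosSq 0 = 1 := by
  simp [cosSq]

theorem eq_zero_of_cosSq_eq_one {t : UnitAddCircle} (h : cosSq t = 1) : t = 0 := by
  have h1 : (fourier 1 t : ℂ).re = 1 := by unfold cosSq at h; linarith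
  have h2 : ‖(fourier 1 t : ℂ)‖ = 1 := by rw [fourier_apply, Circle.norm_coe]
  have h3 : (fourier 1 t : ℂ) = 1 := by
    have h4 := Complex.sq_norm (fourier 1 t : ℂ)
    rw [h2, Complex.normSq_apply, h1] at h4
    exact Complex.ext h1 (by simp only [Complex.one_im]; nlinarith)
  rw [fourier_one, ← Circle.coe_one, Circle.coe_inj, ← AddCircle.toCircle_zero] at h3
  exact AddCircle.injective_toCircle one_ne_zero h3

theorem cosSqCoeff_nonneg (n : ℕ) (m : ℤ) : 0 ≤ cosSqCoeff n m := by
  unfold cosSqCoeff; positivity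

theorem cosSqCoeff_eq_zero {n : ℕ} {m : ℤ} (h : m ∉ Finset.Icc (-n : ℤ) n) :
    cosSqCoeff n m = 0 := by
  rw [Finset.mem_Icc] at h
  rw [cosSqCoeff, Nat.choose_eq_zero_of_lt (by omega), Nat.cast_zero, zero_div]

/-- A Wallis-type bound; the induction rests on (2n+1)(2n+3) ≤ (2n+2)². It bounds the largest
coefficient of `cosSq ^ n` by (2n+1)^(-1/2). -/
theorem four_pow_sq_le (n : ℕ) : (n.centralBinom : ℝ) ^ 2 * (2 * n + 1) ≤ (4 ^ n) ^ 2 := by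
  induction n with
  | zero => simp
  | succ n ih =>
    have h : ((n : ℝ) + 1) * (n + 1).centralBinom = 2 * (2 * n + 1) * n.centralBinom := by
      exact_mod_cast Nat.succ_mul_centralBinom_succ n
    have hn : (0 : ℝ) < (n + 1) ^ 2 := by positivity
    refine le_of_mul_le_mul_left ?_ hn
    calc ((n : ℝ) + 1) ^ 2 * (((n + 1).centralBinom : ℝ) ^ 2 * (2 * (n + 1 : ℕ) + 1))
        = (((n : ℝ) + 1) * (n + 1).centralBinom) ^ 2 * (2 * n + 3) := by push_cast; ring
      _ = ((n.centralBinom : ℝ) ^ 2 * (2 * n + 1)) * (4 * ((2 * n + 1) * (2 * n + 3))) := by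
          rw [h]; ring
      _ ≤ (4 ^ n) ^ 2 * (4 * ((2 * n + 2) * (2 * n + 2))) := by
          refine mul_le_mul ih ?_ (by positivity) (by positivity)
          nlinarith
      _ = _ := by rw [pow_succ]; ring

theorem cosSqCoeff_le (n : ℕ) (m : ℤ) : cosSqCoeff n m ≤ (2 * (n : ℝ) + 1) ^ (-(1 / 2) : ℝ) := by
  have h1 : cosSqCoeff n m ≤ n.centralBinom / 4 ^ n := by
    unfold cosSqCoeff
    gcongr
    exact Nat.choose_le_centralBinom _ _
  refine h1.trans ?_
  have h2 := four_pow_sq_le n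
  rw [Real.rpow_neg (by positivity), ← Real.sqrt_eq_rpow, ← one_div,
    le_div_iff₀ (by positivity)]
  rw [div_mul_eq_mul_div, div_le_one (by positivity)]
  refine abs_le_of_sq_le_sq' ?_ (by positivity) |>.2
  rw [mul_pow, Real.sq_sqrt (by positivity)]
  exact h2

/-- The binomial theorem for (1+z)^(2n), recentred. The field is general because two values are
needed: a character in ℂ gives the Fourier expansion, and z = e^t in ℝ gives the moment generating
function of the coefficients. -/
theorem sum_Icc_cosSqCoeff_mul (n : ℕ) {K : Type*} [Field K] [Algebra ℝ K] {z : K} (hz : z ≠ 0) :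
    ∑ m ∈ Finset.Icc (-n : ℤ) n, algebraMap ℝ K (cosSqCoeff n m) * z ^ m =
      ((1 + z) ^ 2 / (4 * z)) ^ n := by
  have h1 : ∑ m ∈ Finset.Icc (-n : ℤ) n, algebraMap ℝ K (cosSqCoeff n m) * z ^ m =
      ∑ j ∈ Finset.range (2 * n + 1), ((2 * n).choose j : K) / 4 ^ n * (z ^ j / z ^ n) := by
    refine Finset.sum_nbij' (fun m => (m + n).toNat) (fun j => (j : ℤ) - n) ?_ ?_ ?_ ?_ ?_
    · intro m hm; rw [Finset.mem_Icc] at hm; rw [Finset.mem_range]; omega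
    · intro j hj; rw [Finset.mem_range] at hj; rw [Finset.mem_Icc]; omega
    · intro m hm; rw [Finset.mem_Icc] at hm; omega
    · intro j hj; omega
    · intro m hm
      rw [Finset.mem_Icc] at hm
      have h2 : (2 * n).choose (n + m.natAbs) = (2 * n).choose (m + n).toNat := by
        rcases le_total 0 m with h | h
        · congr 1; omega
        · rw [← Nat.choose_symm (by omega)]; congr 1; omega
      have h3 : z ^ m = z ^ (m + n).toNat / z ^ n := by
        rw [eq_div_iff (pow_ne_zero _ hz), ← zpow_natCast, ← zpow_natCast, ← zpow_add₀ hz]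
        congr 1; omega
      rw [cosSqCoeff, h2, h3, map_div₀, map_pow, map_natCast, map_ofNat]
  rw [h1, div_pow, ← pow_mul, add_comm 1 z, add_pow]
  rw [Finset.sum_div]
  refine Finset.sum_congr rfl fun j _ => ?_
  rw [one_pow, mul_one, mul_pow]
  ring

theorem cosSq_pow_eq_sum (n : ℕ) (t : UnitAddCircle) :
    ((cosSq t : ℂ)) ^ n =
      ∑ m ∈ Finset.Icc (-n : ℤ) n, (cosSqCoeff n m : ℂ) * fourier m t := by
  have hz : (fourier 1 t : ℂ) ≠ 0 := by simp [fourier_apply]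
  have h1 := sum_Icc_cosSqCoeff_mul n hz
  have h2 : ∀ m : ℤ, (fourier m t : ℂ) = (fourier 1 t : ℂ) ^ m := fun m => by
    rw [fourier_one, fourier_apply, AddCircle.toCircle_zsmul, Circle.coe_zpow]
  refine Eq.trans ?_ (h1.symm.trans (Finset.sum_congr rfl fun m _ => by rw [h2 m]; rfl))
  congr 1
  have h3 : (fourier 1 t : ℂ) * (starRingEnd ℂ) (fourier 1 t) = 1 := by
    rw [Complex.mul_conj, Complex.normSq_eq_norm_sq, fourier_apply, Circle.norm_coe]; simp
  have h4 : (((fourier 1 t : ℂ).re : ℝ) : ℂ) = (fourier 1 t + (starRingEnd ℂ) (fourier 1 t)) / 2 :=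
    Complex.re_eq_add_conj _
  rw [cosSq, eq_div_iff (mul_ne_zero (by norm_num) hz)]
  push_cast
  rw [h4]
  linear_combination h3

theorem integral_fourier (m : ℤ) :
    ∫ t : UnitAddCircle, (fourier m t : ℂ) ∂AddCircle.haarAddCircle = if m = 0 then 1 else 0 := by
  have h := congrFun (fourierCoeff_fourier (T := (1 : ℝ)) m) 0
  simp only [fourierCoeff, neg_zero, fourier_zero, one_smul] at h
  rw [h, Pi.single_apply]
  simp only [eq_comm]

theorem integral_fourier_mul_cosSq_pow (n : ℕ) (k : ℤ) :
    ∫ t : UnitAddCircle, (fourier (-k) t : ℂ) * (cosSq t : ℂ) ^ n ∂AddCircle.haarAddCircle =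
      cosSqCoeff n k := by
  have h1 : ∀ t : UnitAddCircle, (fourier (-k) t : ℂ) * (cosSq t : ℂ) ^ n =
      ∑ m ∈ Finset.Icc (-n : ℤ) n, (cosSqCoeff n m : ℂ) * fourier (m - k) t := by
    intro t
    rw [cosSq_pow_eq_sum, Finset.mul_sum]
    refine Finset.sum_congr rfl fun m _ => ?_
    rw [sub_eq_add_neg, fourier_add]
    ring
  simp only [h1]
  rw [integral_finsetSum _ fun m _ => ?_]
  · simp only [integral_const_mul, integral_fourier, sub_eq_zero]
    rw [Finset.sum_congr rfl fun m _ => mul_ite _ _ _ _]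
    simp only [mul_one, mul_zero, Finset.sum_ite_eq']
    split_ifs with h
    · rfl
    · rw [cosSqCoeff_eq_zero h, Complex.ofReal_zero]
  · refine Integrable.const_mul ?_ _
    exact (fourier (m - k)).continuous.integrable_of_hasCompactSupport
      (HasCompactSupport.of_compactSpace _)

/-- The function `∏ᵢ cos² (π xᵢ)` on the torus. -/
noncomputable def prodCosSq {d : ℕ} (x : UnitAddTorus (Fin d)) : ℝ := ∏ i, cosSq (x i)

theorem continuous_prodCosSq {d : ℕ} : Continuous (prodCosSq (d := d)) :=
  continuous_finsetProd _ fun i _ => continuous_cosSq.comp (continuous_apply i)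

theorem prodCosSq_nonneg {d : ℕ} (x : UnitAddTorus (Fin d)) : 0 ≤ prodCosSq x :=
  Finset.prod_nonneg fun _ _ => cosSq_nonneg _

theorem prodCosSq_le_one {d : ℕ} (x : UnitAddTorus (Fin d)) : prodCosSq x ≤ 1 :=
  Finset.prod_le_one (fun _ _ => cosSq_nonneg _) fun _ _ => cosSq_le_one _

theorem prodCosSq_zero {d : ℕ} : prodCosSq (0 : UnitAddTorus (Fin d)) = 1 := by
  simp [prodCosSq, cosSq_zero]

theorem prodCosSq_lt_one {d : ℕ} {x : UnitAddTorus (Fin d)} (hx : x ≠ 0) : prodCosSq x < 1 := by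
  obtain ⟨i, hi⟩ := Function.ne_iff.1 hx
  have h1 : cosSq (x i) < 1 :=
    lt_of_le_of_ne (cosSq_le_one _) fun h => hi (eq_zero_of_cosSq_eq_one h)
  refine lt_of_le_of_lt ?_ h1
  rw [prodCosSq, ← Finset.mul_prod_erase _ _ (Finset.mem_univ i)]
  exact mul_le_of_le_one_right (cosSq_nonneg _)
    (Finset.prod_le_one (fun _ _ => cosSq_nonneg _) fun _ _ => cosSq_le_one _)

theorem mFourierCoeff_prodCosSq_pow {d : ℕ} (n : ℕ) (k : Fin d → ℤ) :
    UnitAddTorus.mFourierCoeff (fun x => ((prodCosSq x : ℂ)) ^ n) k =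
      ((∏ i, cosSqCoeff n (k i) : ℝ) : ℂ) := by
  rw [mFourierCoeff_eq_integral_torusMeasure]
  have h : ∀ x : UnitAddTorus (Fin d), UnitAddTorus.mFourier (-k) x * (prodCosSq x : ℂ) ^ n =
      ∏ i, (fourier (-k i) (x i) : ℂ) * (cosSq (x i) : ℂ) ^ n := by
    intro x
    rw [Finset.prod_mul_distrib, Finset.prod_pow, prodCosSq, Complex.ofReal_prod]
    rfl
  simp only [h]
  rw [integral_fintype_prod_eq_prod (f := fun i (t : UnitAddCircle) =>
    (fourier (-k i) t : ℂ) * (cosSq t : ℂ) ^ n)]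
  simp only [integral_fourier_mul_cosSq_pow, Complex.ofReal_prod]

theorem prod_cosSqCoeff_nonneg {d : ℕ} (n : ℕ) (k : Fin d → ℤ) :
    0 ≤ ∏ i, cosSqCoeff n (k i) :=
  Finset.prod_nonneg fun _ _ => cosSqCoeff_nonneg _ _

theorem prod_cosSqCoeff_le {d : ℕ} (n : ℕ) (k : Fin d → ℤ) :
    ∏ i, cosSqCoeff n (k i) ≤ (2 * (n : ℝ) + 1) ^ (-((d : ℝ) / 2)) := by
  refine (Finset.prod_le_prod (fun _ _ => cosSqCoeff_nonneg _ _)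
    fun i _ => cosSqCoeff_le n (k i)).trans (le_of_eq ?_)
  rw [Finset.prod_const, Finset.card_univ, Fintype.card_fin, ← Real.rpow_natCast,
    ← Real.rpow_mul (by positivity)]
  congr 1
  ring

theorem memLp_prodCosSq_pow {d : ℕ} (n : ℕ) :
    MemLp (fun x => ((prodCosSq x : ℂ)) ^ n) 2 (torusMeasure d) := by
  refine MemLp.of_bound (Continuous.aestronglyMeasurable ?_) 1 (.of_forall fun x => ?_)
  · exact (Complex.continuous_ofReal.comp continuous_prodCosSq).pow n
  · rw [norm_pow, Complex.norm_real, Real.norm_of_nonneg (prodCosSq_nonneg x)]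
    exact pow_le_one₀ (prodCosSq_nonneg x) (prodCosSq_le_one x)

/-- The square of this norm is the zeroth Fourier coefficient of the power with exponent 2n. -/
theorem eLpNorm_prodCosSq_pow_le {d : ℕ} (n : ℕ) :
    eLpNorm (fun x => ((prodCosSq x : ℂ)) ^ n) 2 (torusMeasure d) ≤
      ENNReal.ofReal (((n : ℝ) + 1) ^ (-((d : ℝ) / 4))) := by
  rw [(memLp_prodCosSq_pow n).eLpNorm_eq_integral_rpow_norm two_ne_zero ENNReal.ofNat_ne_top]
  refine ENNReal.ofReal_le_ofReal ?_
  have h1 : ∫ x, ‖((prodCosSq x : ℂ)) ^ n‖ ^ (2 : ℝ≥0∞).toReal ∂torusMeasure d =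
      ∏ _i : Fin d, cosSqCoeff (2 * n) 0 := by
    have h2 := mFourierCoeff_prodCosSq_pow (2 * n) (0 : Fin d → ℤ)
    rw [mFourierCoeff_eq_integral_torusMeasure, neg_zero, UnitAddTorus.mFourier_zero] at h2
    apply Complex.ofReal_injective
    rw [← integral_complex_ofReal]
    refine Eq.trans (integral_congr_ae (.of_forall fun x => ?_)) h2
    simp only [ENNReal.toReal_ofNat, Real.rpow_two, norm_pow, Complex.norm_real,
      Real.norm_of_nonneg (prodCosSq_nonneg x), ContinuousMap.one_apply, one_mul]
    push_cast
    rw [← pow_mul, mul_comm]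
  rw [h1]
  have h3 := prod_cosSqCoeff_le (2 * n) (0 : Fin d → ℤ)
  have h4 : (2 * ((2 * n : ℕ) : ℝ) + 1) ^ (-((d : ℝ) / 2)) ≤ ((n : ℝ) + 1) ^ (-((d : ℝ) / 2)) := by
    refine Real.rpow_le_rpow_of_nonpos (by positivity) ?_ (by
      have := Nat.cast_nonneg (α := ℝ) d; linarith)
    push_cast
    have := Nat.cast_nonneg (α := ℝ) n
    linarith
  refine (Real.rpow_le_rpow (prod_cosSqCoeff_nonneg _ (0 : Fin d → ℤ)) (h3.trans h4)
    (by positivity)).trans (le_of_eq ?_)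
  rw [← Real.rpow_mul (by positivity)]
  congr 1
  rw [ENNReal.toReal_ofNat]
  ring

/-! ### Sobolev weights of the powers -/

/-- The sum is ((1 + cosh t)/2)^n ≤ exp(nt²/2) ≤ e^(1/2) < 2: the coefficients have subgaussian
tails at scale √n. -/
theorem sum_Icc_exp_mul_cosSqCoeff_le (n : ℕ) {t : ℝ} (ht : t ^ 2 * (n + 1) = 1) :
    ∑ m ∈ Finset.Icc (-n : ℤ) n, Real.exp (t * m) * cosSqCoeff n m ≤ 2 := by
  have h1 := sum_Icc_cosSqCoeff_mul n (z := Real.exp t) (Real.exp_pos t).ne'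
  have h2 : ∑ m ∈ Finset.Icc (-n : ℤ) n, Real.exp (t * m) * cosSqCoeff n m =
      ((1 + Real.exp t) ^ 2 / (4 * Real.exp t)) ^ n := by
    rw [← h1]
    refine Finset.sum_congr rfl fun m _ => ?_
    rw [mul_comm, Real.exp_mul, Real.rpow_intCast]
    rfl
  have h3 : (1 + Real.exp t) ^ 2 / (4 * Real.exp t) = (1 + Real.cosh t) / 2 := by
    rw [Real.cosh_eq, Real.exp_neg]
    have := (Real.exp_pos t).ne'
    field_simp
    ring
  have h4 : (1 + Real.cosh t) / 2 ≤ Real.exp (t ^ 2 / 2) := by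
    have := Real.one_le_cosh t
    exact le_trans (by linarith) (Real.cosh_le_exp_half_sq t)
  rw [h2, h3]
  refine (pow_le_pow_left₀ (by have := Real.one_le_cosh t; linarith) h4 n).trans ?_
  rw [← Real.exp_nat_mul]
  have h5 : (n : ℝ) * (t ^ 2 / 2) ≤ 1 / 2 := by nlinarith [sq_nonneg t]
  refine (Real.exp_le_exp.2 h5).trans ?_
  have h6 : Real.exp (1 / 2) ^ 2 = Real.exp 1 := by
    rw [← Real.exp_nat_mul]; norm_num
  have h7 := Real.exp_one_lt_d9
  nlinarith [Real.exp_pos (1 / 2)]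

theorem rpow_le_rpow_mul_exp {a y : ℝ} (ha : 0 < a) (hy : 0 ≤ y) : y ^ a ≤ a ^ a * Real.exp y := by
  have h1 : y ≤ a * Real.exp (y / a) := by
    have h2 := Real.add_one_le_exp (y / a)
    have h3 : a * (y / a) = y := by field_simp
    nlinarith
  refine (Real.rpow_le_rpow hy h1 ha.le).trans (le_of_eq ?_)
  rw [Real.mul_rpow ha.le (Real.exp_pos _).le, ← Real.exp_mul, div_mul_cancel₀ _ ha.ne']

theorem norm_toLp_le_sum {d : ℕ} (k : Fin d → ℤ) :
    ‖WithLp.toLp 2 (fun i => (k i : ℝ))‖ ≤ ∑ i, |(k i : ℝ)| := by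
  rw [EuclideanSpace.norm_eq]
  refine Real.sqrt_le_iff.2 ⟨Finset.sum_nonneg fun _ _ => abs_nonneg _, ?_⟩
  simpa only [Real.norm_eq_abs] using
    Finset.sum_sq_le_sq_sum_of_nonneg fun i (_ : i ∈ Finset.univ) => abs_nonneg (k i : ℝ)

/-- With t = (n+1)^(-1/2), the weight |k|^(2s) is at most a constant times (n+1)^s exp(t Σ|kᵢ|).
Bounding e^(t|m|) by e^(tm) + e^(-tm) factors the sum over coordinates, each contributing at most 2
+ 2 = 4. -/
theorem sum_rpow_mul_prod_cosSqCoeff_le {d : ℕ} {s : ℝ} (hs : 0 < s) (n : ℕ)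
    (S : Finset (Fin d → ℤ)) :
    ∑ k ∈ S, ‖WithLp.toLp 2 (fun i => (k i : ℝ))‖ ^ (2 * s) * ∏ i, cosSqCoeff n (k i) ≤
      (2 * s) ^ (2 * s) * 4 ^ d * ((n : ℝ) + 1) ^ s := by
  have hn : (0 : ℝ) < n + 1 := by positivity
  set t : ℝ := ((n : ℝ) + 1) ^ (-(1 / 2) : ℝ) with ht
  have ht0 : 0 < t := by positivity
  have ht2 : t ^ 2 * (n + 1) = 1 := by
    rw [ht, ← Real.rpow_natCast, ← Real.rpow_mul hn.le]
    norm_num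
    rw [Real.rpow_neg_one, inv_mul_cancel₀ hn.ne']
  have hts : t ^ (2 * s) * ((n : ℝ) + 1) ^ s = 1 := by
    rw [ht, ← Real.rpow_mul hn.le, ← Real.rpow_add hn]
    ring_nf
    simp
  set G : ℤ → ℝ := fun m => (Real.exp (t * m) + Real.exp (-t * m)) * cosSqCoeff n m with hG
  have hG0 : ∀ m, 0 ≤ G m := fun m => mul_nonneg (by positivity) (cosSqCoeff_nonneg n m)
  have hexp : ∀ k : Fin d → ℤ, ‖WithLp.toLp 2 (fun i => (k i : ℝ))‖ ^ (2 * s) ≤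
      (2 * s) ^ (2 * s) * ((n : ℝ) + 1) ^ s *
        ∏ i, (Real.exp (t * k i) + Real.exp (-t * k i)) := by
    intro k
    have h1 := rpow_le_rpow_mul_exp (a := 2 * s) (y := t * ∑ i, |(k i : ℝ)|) (by linarith)
      (mul_nonneg ht0.le (Finset.sum_nonneg fun _ _ => abs_nonneg _))
    have h2 : Real.exp (t * ∑ i, |(k i : ℝ)|) ≤
        ∏ i, (Real.exp (t * k i) + Real.exp (-t * k i)) := by
      rw [Finset.mul_sum, Real.exp_sum]
      refine Finset.prod_le_prod (fun _ _ => (Real.exp_pos _).le) fun i _ => ?_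
      rcases abs_choice (k i : ℝ) with h | h
      · rw [h]; linarith [Real.exp_pos (-t * k i)]
      · rw [h, mul_neg, ← neg_mul]; linarith [Real.exp_pos (t * k i)]
    have h3 : ‖WithLp.toLp 2 (fun i => (k i : ℝ))‖ ^ (2 * s) ≤
        ((n : ℝ) + 1) ^ s * (t * ∑ i, |(k i : ℝ)|) ^ (2 * s) := by
      rw [Real.mul_rpow ht0.le (Finset.sum_nonneg fun _ _ => abs_nonneg _), ← mul_assoc,
        mul_comm (_ ^ s), hts, one_mul]
      exact Real.rpow_le_rpow (norm_nonneg _) (norm_toLp_le_sum k) (by linarith)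
    calc _ ≤ ((n : ℝ) + 1) ^ s * ((2 * s) ^ (2 * s) * Real.exp (t * ∑ i, |(k i : ℝ)|)) :=
          h3.trans (mul_le_mul_of_nonneg_left h1 (by positivity))
      _ ≤ ((n : ℝ) + 1) ^ s * ((2 * s) ^ (2 * s) *
          ∏ i, (Real.exp (t * k i) + Real.exp (-t * k i))) := by gcongr
      _ = _ := by ring
  have hsum : ∑ k ∈ S, ∏ i, G (k i) ≤ 4 ^ d := by
    have h1 : ∑ k ∈ S, ∏ i, G (k i) ≤
        ∑ k ∈ Fintype.piFinset fun _ : Fin d => Finset.Icc (-n : ℤ) n, ∏ i, G (k i) := by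
      rw [← Finset.sum_filter_ne_zero]
      refine Finset.sum_le_sum_of_subset_of_nonneg (fun k hk => ?_)
        fun k _ _ => Finset.prod_nonneg fun i _ => hG0 _
      rw [Fintype.mem_piFinset]
      intro i
      by_contra hi
      refine (Finset.mem_filter.1 hk).2 (Finset.prod_eq_zero (Finset.mem_univ i) ?_)
      simp only [hG, cosSqCoeff_eq_zero hi, mul_zero]
    refine h1.trans ?_
    rw [← Finset.prod_univ_sum (fun _ : Fin d => Finset.Icc (-n : ℤ) n) (fun _ m => G m),
      Finset.prod_const, Finset.card_univ, Fintype.card_fin]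
    refine pow_le_pow_left₀ (Finset.sum_nonneg fun m _ => hG0 m) ?_ d
    simp only [hG, add_mul, Finset.sum_add_distrib]
    have h2 := sum_Icc_exp_mul_cosSqCoeff_le n ht2
    have h3 := sum_Icc_exp_mul_cosSqCoeff_le n (t := -t) (by rw [neg_sq]; exact ht2)
    linarith
  calc _ ≤ ∑ k ∈ S, (2 * s) ^ (2 * s) * ((n : ℝ) + 1) ^ s * ∏ i, G (k i) := by
        refine Finset.sum_le_sum fun k _ => ?_
        have := mul_le_mul_of_nonneg_right (hexp k) (prod_cosSqCoeff_nonneg n k)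
        rwa [mul_assoc _ _ (∏ i, cosSqCoeff n (k i)), ← Finset.prod_mul_distrib] at this
    _ = (2 * s) ^ (2 * s) * ((n : ℝ) + 1) ^ s * ∑ k ∈ S, ∏ i, G (k i) := by rw [Finset.mul_sum]
    _ ≤ (2 * s) ^ (2 * s) * ((n : ℝ) + 1) ^ s * 4 ^ d := by gcongr
    _ = _ := by ring

/-- In the squared norm one factor of the coefficient is bounded by (n+1)^(-d/2) and the other is
kept for the weighted sum. -/
theorem exists_norm_weighted_prod_cosSqCoeff_le (d : ℕ) {s : ℝ} (hs : 0 < s) :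
    ∃ C : ℝ, 0 ≤ C ∧ ∀ n : ℕ, ∃ a : lp (fun _ : Fin d → ℤ => ℂ) 2,
      (∀ k, a k = ((‖WithLp.toLp 2 (fun i => (k i : ℝ))‖ ^ s : ℝ) : ℂ) *
        ((∏ i, cosSqCoeff n (k i) : ℝ) : ℂ)) ∧
      ‖a‖ ≤ C * ((n : ℝ) + 1) ^ (s / 2 - d / 4) := by
  set C : ℝ := (2 * s) ^ (2 * s) * 4 ^ d with hC
  have hC0 : 0 ≤ C := by positivity
  refine ⟨√C, Real.sqrt_nonneg _, fun n => ?_⟩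
  have hn : (0 : ℝ) < n + 1 := by positivity
  have hbound : ∀ S : Finset (Fin d → ℤ), ∑ k ∈ S,
      ‖((‖WithLp.toLp 2 (fun i => (k i : ℝ))‖ ^ s : ℝ) : ℂ) *
        ((∏ i, cosSqCoeff n (k i) : ℝ) : ℂ)‖ ^ (2 : ℝ≥0∞).toReal ≤
      (√C * ((n : ℝ) + 1) ^ (s / 2 - d / 4)) ^ (2 : ℝ≥0∞).toReal := by
    intro S
    have h1 : ∀ k : Fin d → ℤ, ‖((‖WithLp.toLp 2 (fun i => (k i : ℝ))‖ ^ s : ℝ) : ℂ) *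
        ((∏ i, cosSqCoeff n (k i) : ℝ) : ℂ)‖ ^ (2 : ℝ≥0∞).toReal ≤
        ((n : ℝ) + 1) ^ (-((d : ℝ) / 2)) *
        (‖WithLp.toLp 2 (fun i => (k i : ℝ))‖ ^ (2 * s) * ∏ i, cosSqCoeff n (k i)) := by
      intro k
      have hp := prod_cosSqCoeff_nonneg n k
      rw [norm_mul, Complex.norm_real, Complex.norm_real, Real.norm_of_nonneg (by positivity),
        Real.norm_of_nonneg hp, ENNReal.toReal_ofNat, Real.rpow_two, mul_pow,
        ← Real.rpow_natCast (_ ^ s), ← Real.rpow_mul (norm_nonneg _), sq (∏ i, _)]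
      have h2 : ∏ i, cosSqCoeff n (k i) ≤ ((n : ℝ) + 1) ^ (-((d : ℝ) / 2)) := by
        refine (prod_cosSqCoeff_le n k).trans (Real.rpow_le_rpow_of_nonpos hn ?_ ?_)
        · have := Nat.cast_nonneg (α := ℝ) n; linarith
        · have := Nat.cast_nonneg (α := ℝ) d; linarith
      have h3 := mul_le_mul_of_nonneg_left (mul_le_mul_of_nonneg_right h2 hp)
        (Real.rpow_nonneg (norm_nonneg (WithLp.toLp 2 (fun i => (k i : ℝ)))) (2 * s))
      refine le_of_eq_of_le ?_ (h3.trans (le_of_eq ?_))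
      · push_cast; ring_nf
      · ring
    refine (Finset.sum_le_sum fun k _ => h1 k).trans ?_
    rw [← Finset.mul_sum]
    refine (mul_le_mul_of_nonneg_left (sum_rpow_mul_prod_cosSqCoeff_le hs n S)
      (by positivity)).trans (le_of_eq ?_)
    rw [ENNReal.toReal_ofNat, Real.rpow_two, mul_pow, Real.sq_sqrt hC0,
      ← Real.rpow_natCast (_ ^ (s / 2 - (d : ℝ) / 4)), ← Real.rpow_mul hn.le, mul_left_comm,
      ← Real.rpow_add hn]
    congr 2
    push_cast
    ring
  refine ⟨⟨_, memℓp_gen' hbound⟩, fun k => rfl, ?_⟩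
  exact lp.norm_le_of_forall_sum_le (by simp) (by positivity) hbound

/-! ### Sums and interpolation in sequence spaces -/

/-- The series converges absolutely in ℓ^q, and continuity of the coordinates identifies its sum
with f. -/
theorem exists_memℓp_of_hasSum {ι : Type*} {q : ℝ≥0∞} [Fact (1 ≤ q)]
    {a : ℕ → lp (fun _ : ι => ℂ) q} {b : ℕ → ℝ} (hb : Summable b) (hab : ∀ n, ‖a n‖ ≤ b n)
    {f : ι → ℂ} (hf : ∀ i, HasSum (fun n => a n i) (f i)) :
    ∃ h : Memℓp f q, ‖(⟨f, h⟩ : lp (fun _ : ι => ℂ) q)‖ ≤ ∑' n, b n := by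
  have hs : Summable a := Summable.of_norm_bounded hb hab
  have hcoe : ((∑' n, a n : lp (fun _ : ι => ℂ) q) : ι → ℂ) = f := by
    funext i
    have h1 := hs.hasSum.map (⟨⟨fun x : lp (fun _ : ι => ℂ) q => x i, rfl⟩, fun _ _ => rfl⟩ :
      lp (fun _ : ι => ℂ) q →+ ℂ) (lp.lipschitzWith_one_eval q i).continuous
    exact h1.unique (hf i)
  have hmem : Memℓp f q := hcoe ▸ lp.memℓp (∑' n, a n)
  have heq : (⟨f, hmem⟩ : lp (fun _ : ι => ℂ) q) = ∑' n, a n := lp.ext hcoe.symm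
  exact ⟨hmem, heq ▸ tsum_of_norm_bounded hb.hasSum hab⟩

/-- Interpolation between ℓ² and ℓ^∞ by |aᵢ|^q ≤ (δA)^(q-2)|aᵢ|². -/
theorem exists_memℓp_of_norm_le {ι : Type*} {q : ℝ≥0∞} (hq : 2 ≤ q)
    (a : lp (fun _ : ι => ℂ) 2) {A δ : ℝ} (hA : 0 ≤ A) (hδ : 0 < δ) (ha : ‖a‖ ≤ A)
    (hi : ∀ i, ‖a i‖ ≤ δ * A) :
    ∃ h : Memℓp (a : ι → ℂ) q,
      ‖(⟨a, h⟩ : lp (fun _ : ι => ℂ) q)‖ ≤ δ ^ (1 - 2 * q.toReal⁻¹) * A := by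
  rcases eq_or_ne q ∞ with rfl | hq'
  · have hmem : Memℓp (a : ι → ℂ) ∞ := memℓp_infty ⟨δ * A, by rintro _ ⟨i, rfl⟩; exact hi i⟩
    refine ⟨hmem, ?_⟩
    simpa using lp.norm_le_of_forall_le (f := (⟨a, hmem⟩ : lp (fun _ : ι => ℂ) ∞))
      (by positivity) hi
  · have hq2 : 2 ≤ q.toReal := by
      simpa using ENNReal.toReal_mono hq' hq
    have hq0 : 0 < q.toReal := by linarith
    have hbound : ∀ S : Finset ι, ∑ i ∈ S, ‖a i‖ ^ q.toReal ≤
        (δ ^ (1 - 2 * q.toReal⁻¹) * A) ^ q.toReal := by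
      intro S
      have h2 := lp.sum_rpow_le_norm_rpow (by simp) a S
      simp only [ENNReal.toReal_ofNat, Real.rpow_two] at h2
      have h1 : ∀ i, ‖a i‖ ^ q.toReal ≤ (δ * A) ^ (q.toReal - 2) * ‖a i‖ ^ 2 := by
        intro i
        rcases eq_or_lt_of_le (norm_nonneg (a i)) with h | h
        · rw [← h, Real.zero_rpow hq0.ne']; simp
        · have h3 : ‖a i‖ ^ q.toReal = ‖a i‖ ^ (q.toReal - 2) * ‖a i‖ ^ 2 := by
            rw [← Real.rpow_natCast, ← Real.rpow_add h]; congr 1; push_cast; ring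
          rw [h3]
          exact mul_le_mul_of_nonneg_right
            (Real.rpow_le_rpow h.le (hi i) (by linarith)) (by positivity)
      refine (Finset.sum_le_sum fun i _ => h1 i).trans ?_
      rw [← Finset.mul_sum]
      have h4 : ∑ i ∈ S, ‖a i‖ ^ 2 ≤ A ^ 2 :=
        h2.trans (pow_le_pow_left₀ (norm_nonneg _) ha 2)
      refine (mul_le_mul_of_nonneg_left h4 (by positivity)).trans (le_of_eq ?_)
      rw [Real.mul_rpow hδ.le hA, Real.mul_rpow (by positivity) hA, ← Real.rpow_mul hδ.le]
      rcases eq_or_lt_of_le hA with h | h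
      · rw [← h, Real.zero_rpow hq0.ne']; simp
      · rw [mul_assoc, ← Real.rpow_natCast A 2, ← Real.rpow_add h]
        congr 2
        · field_simp
        · push_cast; ring
    have hmem : Memℓp (a : ι → ℂ) q := memℓp_gen' hbound
    exact ⟨hmem, lp.norm_le_of_forall_sum_le hq0 (by positivity) hbound⟩

/-! ### Powers of `1 - ∏ᵢ cos² (π xᵢ)` -/

theorem summable_multichoose_mul_rpow {γ b : ℝ} (h0 : -1 < γ) (h1 : γ < 1) (hb : γ < b) :
    Summable fun n : ℕ => |Ring.multichoose γ n| * ((n : ℝ) + 1) ^ (-b) := by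
  have h2 : Summable fun n : ℕ => 4 * ((n : ℝ) + 1) ^ (γ - 1 - b) := by
    have h3 := (summable_nat_add_iff 1).2
      (Real.summable_nat_rpow.2 (show γ - 1 - b < -1 by linarith))
    simpa using h3.mul_left 4
  refine h2.of_nonneg_of_le (fun n => by positivity) fun n => ?_
  refine (mul_le_mul_of_nonneg_right (abs_multichoose_le h0 h1 n) (by positivity)).trans
    (le_of_eq ?_)
  rw [mul_assoc, ← Real.rpow_add (by positivity)]
  rfl

/-- The function `(1 - ∏ᵢ cos² (π xᵢ)) ^ β`. -/
noncomputable def oneSubProdCosSqRpow {d : ℕ} (β : ℝ) (x : UnitAddTorus (Fin d)) : ℂ :=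
  ((1 - prodCosSq x) ^ β : ℝ)

theorem ae_ne_zero_torus {d : ℕ} (hd : 1 ≤ d) : ∀ᵐ x ∂torusMeasure d, x ≠ 0 := by
  rw [ae_iff]
  simp only [not_not, Set.ofPred_eq_eq_singleton]
  refine le_antisymm (ge_of_tendsto' (f := fun j : ℕ => ENNReal.ofReal ((2 * (1 / 2) ^ (j + 1)) ^ d))
    (x := Filter.atTop) ?_ fun j => ?_) bot_le
  · have h1 : Filter.Tendsto (fun j : ℕ => (2 * (1 / 2 : ℝ) ^ (j + 1)) ^ d) Filter.atTop
        (nhds 0) := by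
      have h2 := (tendsto_pow_atTop_nhds_zero_of_lt_one (show (0 : ℝ) ≤ 1 / 2 by norm_num)
        (by norm_num)).comp (Filter.tendsto_add_atTop_nat 1)
      have h3 := (h2.const_mul 2).pow d
      rwa [mul_zero, zero_pow (by omega)] at h3
    simpa using ENNReal.tendsto_ofReal h1
  · have h1 : (1 / 2 : ℝ) ^ (j + 1) ≤ 1 / 2 := by
      rw [pow_succ]
      exact mul_le_of_le_one_left (by norm_num) (pow_le_one₀ (by norm_num) (by norm_num))
    rw [← torusMeasure_closedBall (0 : UnitAddTorus (Fin d)) (by positivity) (by linarith)]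
    exact measure_mono (Set.singleton_subset_iff.2 (Metric.mem_closedBall_self (by positivity)))

theorem ae_hasSum_oneSubProdCosSqRpow {d : ℕ} (hd : 1 ≤ d) (γ : ℝ) :
    ∀ᵐ x ∂torusMeasure d, HasSum (fun n => ((Ring.multichoose γ n : ℝ) : ℂ) * (prodCosSq x : ℂ) ^ n)
      (oneSubProdCosSqRpow (-γ) x) := by
  filter_upwards [ae_ne_zero_torus hd] with x hx
  have h := hasSum_multichoose_mul_pow γ (z := prodCosSq x)
    (by rw [abs_of_nonneg (prodCosSq_nonneg x)]; exact prodCosSq_lt_one hx)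
  have h2 := Complex.hasSum_ofReal.2 h
  simpa only [oneSubProdCosSqRpow, Complex.ofReal_mul, Complex.ofReal_pow] using h2

theorem memLp_oneSubProdCosSqRpow {d : ℕ} (hd : 1 ≤ d) {γ : ℝ} (h0 : -1 < γ) (h1 : γ < 1)
    (hγ : γ < (d : ℝ) / 4) : MemLp (oneSubProdCosSqRpow (-γ)) 2 (torusMeasure d) := by
  have hmeas : AEStronglyMeasurable (oneSubProdCosSqRpow (-γ)) (torusMeasure d) := by
    refine Measurable.aestronglyMeasurable (Complex.measurable_ofReal.comp ?_)
    exact ((measurable_const.sub continuous_prodCosSq.measurable).pow_const _)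
  have hsum := summable_multichoose_mul_rpow h0 h1 hγ
  refine ⟨hmeas, ?_⟩
  set F : ℕ → UnitAddTorus (Fin d) → ℂ := fun n x =>
    ((Ring.multichoose γ n : ℝ) : ℂ) * (prodCosSq x : ℂ) ^ n with hF
  have hFm : ∀ n, AEStronglyMeasurable (F n) (torusMeasure d) := fun n =>
    (memLp_prodCosSq_pow n).1.const_mul _
  have hFn : ∀ n, eLpNorm (F n) 2 (torusMeasure d) ≤
      ENNReal.ofReal (|Ring.multichoose γ n| * ((n : ℝ) + 1) ^ (-((d : ℝ) / 4))) := by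
    intro n
    have : F n = ((Ring.multichoose γ n : ℝ) : ℂ) • fun x => (prodCosSq x : ℂ) ^ n := rfl
    rw [this, eLpNorm_const_smul, ENNReal.ofReal_mul (abs_nonneg _)]
    refine mul_le_mul' (le_of_eq ?_) (eLpNorm_prodCosSq_pow_le n)
    rw [← ofReal_norm, Complex.norm_real, Real.norm_eq_abs]
  refine lt_of_le_of_lt ?_ (ENNReal.ofReal_lt_top (r := ∑' n : ℕ,
    |Ring.multichoose γ n| * ((n : ℝ) + 1) ^ (-((d : ℝ) / 4))))
  -- Fatou for the partial sums, whose norms are bounded by Minkowski.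
  refine (Lp.eLpNorm_lim_le_liminf_eLpNorm (f := fun N => ∑ n ∈ Finset.range N, F n)
    (fun N => Finset.aestronglyMeasurable_sum _ fun n _ => hFm n) _ ?_).trans ?_
  · filter_upwards [ae_hasSum_oneSubProdCosSqRpow hd γ] with x hx
    simpa only [Finset.sum_apply] using hx.tendsto_sum_nat
  · refine Filter.liminf_le_of_frequently_le' (Filter.Frequently.of_forall fun N => ?_)
    refine (eLpNorm_sum_le (fun n _ => hFm n) one_le_two).trans ?_
    refine (Finset.sum_le_sum fun n _ => hFn n).trans ?_
    rw [← ENNReal.ofReal_sum_of_nonneg fun n _ => by positivity]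
    exact ENNReal.ofReal_le_ofReal (hsum.sum_le_tsum _ fun n _ => by positivity)

theorem memLp_prodCosSq_pow_mul {d : ℕ} (n : ℕ) {f : UnitAddTorus (Fin d) → ℂ}
    (hf : MemLp f 2 (torusMeasure d)) :
    MemLp (fun x => (prodCosSq x : ℂ) ^ n * f x) 2 (torusMeasure d) := by
  refine hf.mono ((memLp_prodCosSq_pow n).1.mul hf.1) (.of_forall fun x => ?_)
  rw [norm_mul, norm_pow, Complex.norm_real, Real.norm_of_nonneg (prodCosSq_nonneg x)]
  exact mul_le_of_le_one_left (norm_nonneg _)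
    (pow_le_one₀ (prodCosSq_nonneg x) (prodCosSq_le_one x))

theorem norm_fourierSeq_prodCosSq_pow_mul_le {d : ℕ} (n : ℕ) {f : UnitAddTorus (Fin d) → ℂ}
    (hf : MemLp f 2 (torusMeasure d)) :
    ‖fourierSeq (memLp_prodCosSq_pow_mul n hf)‖ ≤ ‖fourierSeq hf‖ := by
  rw [norm_fourierSeq, norm_fourierSeq]
  refine ENNReal.toReal_mono hf.2.ne (eLpNorm_mono fun x => ?_)
  rw [norm_mul, norm_pow, Complex.norm_real, Real.norm_of_nonneg (prodCosSq_nonneg x)]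
  exact mul_le_of_le_one_left (norm_nonneg _)
    (pow_le_one₀ (prodCosSq_nonneg x) (prodCosSq_le_one x))

theorem integral_norm_prodCosSq_pow_mul_le {d : ℕ} (n : ℕ) {f : UnitAddTorus (Fin d) → ℂ}
    (hf : MemLp f 2 (torusMeasure d)) :
    ∫ x, ‖(prodCosSq x : ℂ) ^ n * f x‖ ∂torusMeasure d ≤
      ((n : ℝ) + 1) ^ (-((d : ℝ) / 4)) * ‖fourierSeq hf‖ := by
  have h1 : AEStronglyMeasurable (fun x => (prodCosSq x : ℂ) ^ n * f x) (torusMeasure d) :=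
    (memLp_prodCosSq_pow_mul n hf).1
  rw [integral_norm_eq_lintegral_enorm h1, ← eLpNorm_one_eq_lintegral_enorm]
  have h2 := eLpNorm_smul_le_mul_eLpNorm (p := 2) (q := 2) (r := 1) hf.1
    (memLp_prodCosSq_pow (d := d) n).1
  have h3 : eLpNorm f 2 (torusMeasure d) = ENNReal.ofReal ‖fourierSeq hf‖ := by
    rw [norm_fourierSeq, ENNReal.ofReal_toReal hf.2.ne]
  refine ENNReal.toReal_le_of_le_ofReal (by positivity) (h2.trans ?_)
  rw [ENNReal.ofReal_mul (by positivity), h3]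
  exact mul_le_mul_left (eLpNorm_prodCosSq_pow_le n) _

theorem norm_mFourierCoeff_prodCosSq_pow_mul_le {d : ℕ} (n : ℕ) {f : UnitAddTorus (Fin d) → ℂ}
    (hf : MemLp f 2 (torusMeasure d)) (k : Fin d → ℤ) :
    ‖UnitAddTorus.mFourierCoeff (fun x => (prodCosSq x : ℂ) ^ n * f x) k‖ ≤
      ((n : ℝ) + 1) ^ (-((d : ℝ) / 4)) * ‖fourierSeq hf‖ := by
  rw [mFourierCoeff_eq_integral_torusMeasure]
  refine (norm_integral_le_integral_norm _).trans ?_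
  simp only [norm_mul (UnitAddTorus.mFourier _ _), norm_mFourier_apply, one_mul]
  exact integral_norm_prodCosSq_pow_mul_le n hf

/-- Termwise integration is justified by summability of the L¹ norms. It serves γ = β for the
multiplier and γ = -β with f = 1 for the Sobolev norm. -/
theorem hasSum_mFourierCoeff_oneSubProdCosSqRpow_mul {d : ℕ} (hd : 1 ≤ d) {γ : ℝ} (h0 : -1 < γ)
    (h1 : γ < 1) (hγ : γ < (d : ℝ) / 4) {f : UnitAddTorus (Fin d) → ℂ}
    (hf : MemLp f 2 (torusMeasure d)) (k : Fin d → ℤ) :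
    HasSum (fun n => ((Ring.multichoose γ n : ℝ) : ℂ) *
        UnitAddTorus.mFourierCoeff (fun x => (prodCosSq x : ℂ) ^ n * f x) k)
      (UnitAddTorus.mFourierCoeff (fun x => oneSubProdCosSqRpow (-γ) x * f x) k) := by
  set F : ℕ → UnitAddTorus (Fin d) → ℂ := fun n x => ((Ring.multichoose γ n : ℝ) : ℂ) *
    (UnitAddTorus.mFourier (-k) x * ((prodCosSq x : ℂ) ^ n * f x)) with hF
  have hint : ∀ n, Integrable (F n) (torusMeasure d) := by
    intro n
    refine Integrable.const_mul ?_ _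
    refine ((memLp_prodCosSq_pow_mul n hf).integrable one_le_two).bdd_mul (c := 1)
      (UnitAddTorus.mFourier (-k)).continuous.aestronglyMeasurable
      (.of_forall fun x => (norm_mFourier_apply _ _).le)
  have hnorm : Summable fun n => ∫ x, ‖F n x‖ ∂torusMeasure d := by
    refine ((summable_multichoose_mul_rpow h0 h1 hγ).mul_right ‖fourierSeq hf‖).of_nonneg_of_le
      (fun n => integral_nonneg fun x => norm_nonneg _) fun n => ?_
    simp only [hF, norm_mul ((Ring.multichoose γ n : ℝ) : ℂ), norm_mul (UnitAddTorus.mFourier _ _),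
      norm_mFourier_apply, one_mul, integral_const_mul, Complex.norm_real, Real.norm_eq_abs]
    rw [mul_assoc]
    exact mul_le_mul_of_nonneg_left (integral_norm_prodCosSq_pow_mul_le n hf) (abs_nonneg _)
  have h := hasSum_integral_of_summable_integral_norm hint hnorm
  have h2 : ∫ x, ∑' n, F n x ∂torusMeasure d =
      UnitAddTorus.mFourierCoeff (fun x => oneSubProdCosSqRpow (-γ) x * f x) k := by
    rw [mFourierCoeff_eq_integral_torusMeasure]
    refine integral_congr_ae ?_
    filter_upwards [ae_hasSum_oneSubProdCosSqRpow hd γ] with x hx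
    have h3 := (hx.mul_right (f x)).mul_left (UnitAddTorus.mFourier (-k) x)
    refine Eq.trans (tsum_congr fun n => ?_) h3.tsum_eq
    simp only [hF]
    ring
  rw [h2] at h
  refine h.congr_fun fun n => ?_
  rw [mFourierCoeff_eq_integral_torusMeasure, ← integral_const_mul]

theorem isTwoMultiplier_oneSubProdCosSqRpow {d : ℕ} (hd : 1 ≤ d) {q : ℝ≥0∞} (hq : 2 ≤ q) {β : ℝ}
    (h0 : 0 < β) (h1 : β < 1) (hβ : β < (d : ℝ) / 4 * (1 - 2 * q.toReal⁻¹)) :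
    IsTwoMultiplier d q (oneSubProdCosSqRpow (-β)) := by
  have : Fact (1 ≤ q) := ⟨one_le_two.trans hq⟩
  have hβd : β < (d : ℝ) / 4 := by
    refine hβ.trans_le (mul_le_of_le_one_right (by positivity) ?_)
    have : 0 ≤ q.toReal⁻¹ := by positivity
    linarith
  refine ⟨memLp_oneSubProdCosSqRpow hd (by linarith) h1 hβd, ?_⟩
  have hsum := summable_multichoose_mul_rpow (by linarith) h1 hβ
  refine ⟨∑' n : ℕ, |Ring.multichoose β n| *
    ((n : ℝ) + 1) ^ (-((d : ℝ) / 4 * (1 - 2 * q.toReal⁻¹))), fun a => ?_⟩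
  obtain ⟨f, hf, rfl⟩ := exists_fourierSeq_eq a
  have hterm : ∀ n : ℕ, ∃ b : lp (fun _ : Fin d → ℤ => ℂ) q,
      (∀ k, b k = ((Ring.multichoose β n : ℝ) : ℂ) *
        UnitAddTorus.mFourierCoeff (fun x => (prodCosSq x : ℂ) ^ n * f x) k) ∧
      ‖b‖ ≤ |Ring.multichoose β n| *
        ((n : ℝ) + 1) ^ (-((d : ℝ) / 4 * (1 - 2 * q.toReal⁻¹))) * ‖fourierSeq hf‖ := by
    intro n
    obtain ⟨hmem, hle⟩ := exists_memℓp_of_norm_le hq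
      (fourierSeq (memLp_prodCosSq_pow_mul n hf)) (norm_nonneg (fourierSeq hf))
      (δ := ((n : ℝ) + 1) ^ (-((d : ℝ) / 4))) (by positivity)
      (norm_fourierSeq_prodCosSq_pow_mul_le n hf) (fun k => by
        rw [fourierSeq_apply]; exact norm_mFourierCoeff_prodCosSq_pow_mul_le n hf k)
    refine ⟨((Ring.multichoose β n : ℝ) : ℂ) • ⟨_, hmem⟩, fun k => ?_, ?_⟩
    · rw [lp.coeFn_smul, Pi.smul_apply, smul_eq_mul]
      exact congrArg _ (fourierSeq_apply _ k)
    · refine (norm_smul_le _ _).trans ?_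
      rw [Complex.norm_real, Real.norm_eq_abs, mul_assoc]
      refine mul_le_mul_of_nonneg_left (hle.trans (le_of_eq ?_)) (abs_nonneg _)
      rw [← Real.rpow_mul (by positivity), neg_mul]
  choose b hb hbn using hterm
  rw [← tsum_mul_right]
  refine exists_memℓp_of_hasSum (hsum.mul_right _) hbn fun k => ?_
  rw [multiplierSeq_fourierSeq]
  simp only [hb]
  exact hasSum_mFourierCoeff_oneSubProdCosSqRpow_mul hd (by linarith) h1 hβd hf k

theorem memSobolevTorus_oneSubProdCosSqRpow {d : ℕ} (hd : 1 ≤ d) {s β : ℝ} (hs : 0 < s)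
    (h0 : 0 < β) (h1 : β < 1) (hβ : s / 2 - d / 4 < β) :
    MemSobolevTorus d s (oneSubProdCosSqRpow β) := by
  have hd0 : (0 : ℝ) < d := by exact_mod_cast hd
  have hβd : -β < (d : ℝ) / 4 := by linarith [show 0 < (d : ℝ) / 4 by positivity]
  have hmem := memLp_oneSubProdCosSqRpow hd (γ := -β) (by linarith) (by linarith) hβd
  rw [neg_neg] at hmem
  refine ⟨hmem, ?_⟩
  have hone : MemLp (fun _ => (1 : ℂ)) 2 (torusMeasure d) := memLp_const 1
  have hcoeff := hasSum_mFourierCoeff_oneSubProdCosSqRpow_mul hd (γ := -β) (by linarith)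
    (by linarith) hβd hone
  simp only [mul_one, neg_neg, mFourierCoeff_prodCosSq_pow] at hcoeff
  obtain ⟨C, hC, hCa⟩ := exists_norm_weighted_prod_cosSqCoeff_le d hs
  choose a ha han using hCa
  have hsum := (summable_multichoose_mul_rpow (γ := -β) (b := -(s / 2 - d / 4)) (by linarith)
    (by linarith) (by linarith)).mul_left C
  obtain ⟨h, -⟩ := exists_memℓp_of_hasSum (q := 2)
    (a := fun n => ((Ring.multichoose (-β) n : ℝ) : ℂ) • a n) hsum (fun n => by
      refine (norm_smul_le _ _).trans ?_
      rw [Complex.norm_real, Real.norm_eq_abs, neg_neg, mul_left_comm]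
      exact mul_le_mul_of_nonneg_left (han n) (abs_nonneg _))
    (f := fun k => ((‖WithLp.toLp 2 (fun i => (k i : ℝ))‖ ^ s : ℝ) : ℂ) *
      UnitAddTorus.mFourierCoeff (oneSubProdCosSqRpow β) k) (fun k => by
      refine ((hcoeff k).mul_left _).congr_fun fun n => ?_
      rw [lp.coeFn_smul, Pi.smul_apply, smul_eq_mul, ha]
      ring)
  have h2 := h.summable (by simp)
  refine h2.congr fun k => ?_
  rw [norm_mul, Complex.norm_real, Real.norm_of_nonneg (by positivity), ENNReal.toReal_ofNat,
    Real.rpow_two, mul_pow, ← Real.rpow_natCast (_ ^ s), ← Real.rpow_mul (norm_nonneg _)]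
  congr 2
  push_cast
  ring

theorem hasZeroTorus_oneSubProdCosSqRpow (d : ℕ) {β : ℝ} (h0 : 0 < β) :
    HasZeroTorus d (oneSubProdCosSqRpow β) := by
  refine ⟨oneSubProdCosSqRpow β, ?_, ae_eq_rfl, 0, ?_⟩
  · exact Complex.continuous_ofReal.comp
      ((continuous_const.sub continuous_prodCosSq).rpow_const fun _ => Or.inr h0.le)
  · rw [oneSubProdCosSqRpow, prodCosSq_zero, sub_self, Real.zero_rpow h0.ne', Complex.ofReal_zero]

theorem recipIsTwoMultiplier_oneSubProdCosSqRpow {d : ℕ} (hd : 1 ≤ d) {q : ℝ≥0∞} (hq : 2 ≤ q)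
    {β : ℝ} (h0 : 0 < β) (h1 : β < 1) (hβ : β < (d : ℝ) / 4 * (1 - 2 * q.toReal⁻¹)) :
    RecipIsTwoMultiplier d q (oneSubProdCosSqRpow β) := by
  refine ⟨?_, ?_⟩
  · filter_upwards [ae_ne_zero_torus hd] with x hx
    have := prodCosSq_lt_one hx
    exact Complex.ofReal_ne_zero.2 (Real.rpow_pos_of_pos (by linarith) β).ne'
  · have h2 : (fun x : UnitAddTorus (Fin d) => 1 / oneSubProdCosSqRpow β x) =
        oneSubProdCosSqRpow (-β) := by
      funext x
      rw [oneSubProdCosSqRpow, oneSubProdCosSqRpow,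
        Real.rpow_neg (sub_nonneg.2 (prodCosSq_le_one x)), Complex.ofReal_inv, one_div]
    rw [h2]
    exact isTwoMultiplier_oneSubProdCosSqRpow hd hq h0 h1 hβ

/-! ### The theorem -/

theorem theorem1p1 (d : ℕ) (hd : 1 ≤ d) (s : ℝ) (hs : (d : ℝ) / 2 < s) (hsd : s ≤ d) :
    (s < (d : ℝ) / 2 + 1 →
      (∀ w : UnitAddTorus (Fin d) → ℂ, MemSobolevTorus d s w → HasZeroTorus d w →
        ∀ q : ℝ≥0∞, 2 ≤ q → q ≤ (d : ℝ≥0∞) / ENNReal.ofReal ((d : ℝ) - s) →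
          ¬ RecipIsTwoMultiplier d q w) ∧
      (∀ q : ℝ≥0∞, (d : ℝ≥0∞) / ENNReal.ofReal ((d : ℝ) - s) < q →
        ∃ w : UnitAddTorus (Fin d) → ℂ, MemSobolevTorus d s w ∧ HasZeroTorus d w ∧
          RecipIsTwoMultiplier d q w)) ∧
    (s = (d : ℝ) / 2 + 1 →
      ∀ w : UnitAddTorus (Fin d) → ℂ, MemSobolevTorus d s w → HasZeroTorus d w →
        ∀ q : ℝ≥0∞, 2 ≤ q → q < (2 * d : ℝ≥0∞) / ENNReal.ofReal ((d : ℝ) - 2) →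
          ¬ RecipIsTwoMultiplier d q w) := by
  have hd0 : (0 : ℝ) < d := by exact_mod_cast hd
  refine ⟨fun hs1 => ⟨fun w hw hz q hq2 hq => ?_, fun q hq => ?_⟩, fun hs1 w hw hz q hq2 hq => ?_⟩
  · exact not_recipIsTwoMultiplier_of_hasZero hd hs hs1 hw hz (by positivity)
      (sub_le_mul_inv_toReal hq2 hq)
  -- For s = d the threshold is ∞ and no q exceeds it.
  · have hds : 0 < (d : ℝ) - s := by
      refine lt_of_le_of_ne (sub_nonneg.2 hsd) fun h => ?_
      rw [← h, ENNReal.ofReal_zero, ENNReal.div_zero (by exact_mod_cast hd0.ne')] at hq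
      exact not_top_lt hq
    rw [show (d : ℝ≥0∞) / ENNReal.ofReal ((d : ℝ) - s) = ENNReal.ofReal (d / (d - s)) by
      rw [ENNReal.ofReal_div_of_pos hds, ENNReal.ofReal_natCast]] at hq
    have h2 : (2 : ℝ) ≤ d / (d - s) := by rw [le_div_iff₀ hds]; linarith
    have hq2 : 2 ≤ q := by
      refine le_trans ?_ hq.le
      rw [← ENNReal.ofReal_ofNat]
      exact ENNReal.ofReal_le_ofReal h2
    -- This restates q > d/(d-s) as nonemptiness of the interval for β.
    have hqs : (s - d / 2) / 2 < (d : ℝ) / 4 * (1 - 2 * q.toReal⁻¹) := by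
      rcases eq_or_ne q ∞ with rfl | hqt
      · rw [ENNReal.toReal_top, inv_zero]
        linarith
      · have hq0 : 0 < q.toReal := ENNReal.toReal_pos (by positivity) hqt
        have h3 := (ENNReal.ofReal_lt_iff_lt_toReal (by positivity) hqt).1 hq
        rw [div_lt_iff₀ hds] at h3
        have h4 : d * q.toReal⁻¹ < d - s := by
          rw [← div_eq_mul_inv, div_lt_iff₀ hq0]
          linarith
        linarith
    -- The lower bound puts w in the Sobolev space, the first upper bound makes 1/w a multiplier,
    -- and β < 1 is required by the coefficient estimate.
    obtain ⟨β, hβ, hβ'⟩ := exists_between (lt_min hqs (show (s - d / 2) / 2 < 1 by linarith))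
    obtain ⟨hβ1, hβ2⟩ := lt_min_iff.1 hβ'
    have hβ0 : 0 < β := by linarith
    exact ⟨oneSubProdCosSqRpow β,
      memSobolevTorus_oneSubProdCosSqRpow hd (by linarith) hβ0 hβ2 (by linarith),
      hasZeroTorus_oneSubProdCosSqRpow d hβ0,
      recipIsTwoMultiplier_oneSubProdCosSqRpow hd hq2 hβ0 hβ2 hβ1⟩
  · obtain ⟨s', hs', hs1', hq'⟩ := exists_smaller_order hd hq2 hq
    exact not_recipIsTwoMultiplier_of_hasZero hd hs' hs1'
      (hw.mono (by linarith) (by linarith)) hz (by positivity) hq'
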